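/- Let $n\ge 2$, let $S_n$ be the space of real symmetric $n\times n$ matrices, and let $F:\mathbb R^n\times\mathbb R\times\mathbb R^n\times S_n\to\mathbb R$, $(x,r,\theta,A)\mapsto F(x,r,\theta,A)$, be continuous, nonincreasing in $r$ (proper), nondecreasing in $A$ for the usual order of symmetric matrices (degenerate elliptic), and rotationally invariant: $F(\rho x,r,\rho\theta,\rho A\rho^T)=F(x,r,\theta,A)$ for all $\rho\in SO(n)$. Let $p\in(0,1)$ and assume that for every $\theta\in\mathbb R^n$ the set $$\{(x,t,A)\in\mathbb R^n\times(0,\infty)\times S_n:\ F(x,t^{1/p},t^{1/p-1}\theta,t^{1/p-3}A)\ge 0\}$$ is convex. For a bounded open set $D\subset\mathbb R^n$, a classical solution of the Dirichlet problem in $D$ is a function $w\in C^2(D)\cap C(\overline D)$ with $F(x,w,Dw,D^2w)=0$ and $w>0$ in $D$, $w=0$ on $\partial D$. Let $\Omega\subset\mathbb R^n$ be a nonempty bounded open convex set and $u$ a classical solution of the Dirichlet problem in $\Omega$ such that $\liminf_{\Omega\ni y\to x}\partial u(y)/\partial\nu>0$ for every $x\in\partial\Omega$ and every direction $\nu$ pointing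 from $x$ into $\Omega$. Let $w(\Omega)=\frac1{n\omega_n}\int_{S^{n-1}}(h(\xi)+h(-\xi))\,d\xi$ be the mean width of $\Omega$, where $h(\xi)=\max_{y\in\overline\Omega}\langle \xi,y\rangle$ and $\omega_n$ is the volume of the unit ball. For a sequence $\rho=(\rho_i)_{i\ge1}$ in $SO(n)$ and $m\ge 1$ put $\Omega_m^\sharp=\frac1m(\rho_1\Omega+\dots+\rho_m\Omega)$ and, for $x\in\overline{\Omega_m^\sharp}$, $$u_{p,m}^\sharp(x)=\sup\Big\{\Big(\tfrac1m\sum_{i=1}^m u(\rho_i^{-1}x_i)^p\Big)^{1/p}:\ x_i\in\rho_i\overline\Omega,\ x=\tfrac1m\sum_{i=1}^m x_i\Big\},$$ extended by $0$ to the rest of $\mathbb R^n$. Call $\rho$ symmetrizing, with limit $\Omega^\sharp$, if $\Omega_m^\sharp$ converges in the Hausdorff metric to an open ball $\Omega^\sharp$ of diameter $w(\Omega)$; a mean-width rearrangement $u_p^\sharp$ of $u$ along $\rho$ is then any uniform limit on $\overline{\Omega^\sharp}$ of a subsequence of $(u_{p,m}^\sharp)_m$. Then: (0) There is a symmetrizing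 sequence whose limit is the ball centred at the origin, and along every symmetrizing sequence a mean-width rearrangement of $u$ exists. Moreover, let $\rho$ be any symmetrizing sequence, with limit $\Omega^\sharp$, and assume that $F$ satisfies the comparison principle in $\Omega^\sharp$: if $f\in C^2(\Omega^\sharp)\cap C(\overline{\Omega^\sharp})$ is a classical supersolution ($F(x,f,Df,D^2f)\le0$) and $g\in C(\overline{\Omega^\sharp})$ a viscosity subsolution of $F=0$ in $\Omega^\sharp$ with $g\le f$ on $\partial\Omega^\sharp$, then $g\le f$ in $\Omega^\sharp$. Let $v$ be a classical solution of the Dirichlet problem in $\Omega^\sharp$. Then: (1) $u_p^\sharp\le v$ in $\Omega^\sharp$ for every mean-width rearrangement $u_p^\sharp$ of $u$ along $\rho$; (2) $\|u\|_{L^q(\Omega)}\le\|v\|_{L^q(\Omega^\sharp)}$ for every $q\in(0,\infty]$. -/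

import Mathlib

open Set Filter Topology MeasureTheory Metric
open scoped Pointwise ENNReal

noncomputable section

namespace MeanWidth

/-- Euclidean space of dimension `n`. -/
abbrev Eu (n : ℕ) : Type := EuclideanSpace ℝ (Fin n)

/-- Real `n × n` matrices. The set of symmetric ones is cut out by `Matrix.IsSymm`. -/
abbrev Mat (n : ℕ) : Type := Matrix (Fin n) (Fin n) ℝ

/-- The rotation group `SO(n)`. -/
abbrev Rot (n : ℕ) : Type := Matrix.specialOrthogonalGroup (Fin n) ℝ

/-- A second order operator `F(x, u, θ, A)`. Only its values at symmetric `A` are ever used: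
every property below is required, and `F` is evaluated, for symmetric matrices only. -/
abbrev Operator (n : ℕ) : Type := Eu n → ℝ → Eu n → Mat n → ℝ

variable {n : ℕ}

/-! ### Operators -/

/-- `F` is continuous on `ℝⁿ × ℝ × ℝⁿ × Sₙ`. -/
def IsContinuous (F : Operator n) : Prop :=
  ContinuousOn (fun z : Eu n × ℝ × Eu n × Mat n => F z.1 z.2.1 z.2.2.1 z.2.2.2)
    {z | z.2.2.2.IsSymm}

/-- `F` is proper: nonincreasing in the unknown. -/
def IsProper (F : Operator n) : Prop :=
  ∀ (x : Eu n) (r s : ℝ) (θ : Eu n) (A : Mat n), A.IsSymm → s ≤ r → F x r θ A ≤ F x s θ A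

/-- `F` is degenerate elliptic on the whole of `Sₙ`. -/
def IsDegenerateElliptic (F : Operator n) : Prop :=
  ∀ (x : Eu n) (r : ℝ) (θ : Eu n) (A B : Mat n), A.IsSymm → B.IsSymm →
    (B - A).PosSemidef → F x r θ A ≤ F x r θ B

/-- The action of a rotation on `ℝⁿ`. -/
def rot (ρ : Rot n) : Eu n → Eu n := Matrix.toEuclideanLin (ρ : Mat n)

/-- `F` is rotationally invariant. -/
def IsRotationInvariant (F : Operator n) : Prop :=
  ∀ (ρ : Rot n) (x : Eu n) (r : ℝ) (θ : Eu n) (A : Mat n), A.IsSymm →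
    F (rot ρ x) r (rot ρ θ) ((ρ : Mat n) * A * (ρ : Mat n).transpose) = F x r θ A

/-- `G_p^{(θ)}(x, t, A) = F(x, t^{1/p}, t^{1/p-1} θ, t^{1/p-3} A)`. -/
def G (F : Operator n) (p : ℝ) (θ : Eu n) (x : Eu n) (t : ℝ) (A : Mat n) : ℝ :=
  F x (t ^ (1 / p)) (t ^ (1 / p - 1) • θ) (t ^ (1 / p - 3) • A)

/-- The set `{(x, t, A) ∈ ℝⁿ × (0, ∞) × Sₙ : G_p^{(θ)}(x, t, A) ≥ 0}`. -/
def superlevelG (F : Operator n) (p : ℝ) (θ : Eu n) : Set (Eu n × ℝ × Mat n) :=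
  {z | 0 < z.2.1 ∧ z.2.2.IsSymm ∧ 0 ≤ G F p θ z.1 z.2.1 z.2.2}

/-! ### Classical and viscosity notions -/

/-- The Hessian matrix of `u` at `x`. -/
def hessian (u : Eu n → ℝ) (x : Eu n) : Mat n :=
  Matrix.of fun i j =>
    fderiv ℝ (fderiv ℝ u) x (EuclideanSpace.single i 1) (EuclideanSpace.single j 1)

/-- `F(x, u(x), Du(x), D²u(x))`. -/
def applyOp (F : Operator n) (u : Eu n → ℝ) (x : Eu n) : ℝ :=
  F x (u x) (gradient u x) (hessian u x)

/-- `u ∈ C²(Ω) ∩ C(Ω̄)` solves `F(x, u, Du, D²u) = 0` and `u > 0` in `Ω`, `u = 0` on `∂Ω`. -/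
structure IsClassicalSolution (F : Operator n) (Ω : Set (Eu n)) (u : Eu n → ℝ) : Prop where
  contDiffOn : ContDiffOn ℝ 2 u Ω
  continuousOn : ContinuousOn u (closure Ω)
  eqn : ∀ x ∈ Ω, applyOp F u x = 0
  boundary : ∀ x ∈ frontier Ω, u x = 0
  pos : ∀ x ∈ Ω, 0 < u x

/-- `u ∈ C²(Ω) ∩ C(Ω̄)` is a classical supersolution of `F = 0` in `Ω`. -/
structure IsClassicalSupersolution (F : Operator n) (Ω : Set (Eu n)) (u : Eu n → ℝ) :
    Prop where
  contDiffOn : ContDiffOn ℝ 2 u Ω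
  continuousOn : ContinuousOn u (closure Ω)
  le : ∀ x ∈ Ω, applyOp F u x ≤ 0

/-- `φ` touches `u` from above at `x`. -/
def TouchesAbove (φ u : Eu n → ℝ) (x : Eu n) : Prop :=
  φ x = u x ∧ ∀ᶠ y in 𝓝 x, u y ≤ φ y

/-- `u` is a viscosity subsolution of `F = 0` in the open set `Ω`. -/
structure IsViscositySubsolution (F : Operator n) (Ω : Set (Eu n)) (u : Eu n → ℝ) :
    Prop where
  usc : UpperSemicontinuousOn u Ω
  ge : ∀ x ∈ Ω, ∀ φ : Eu n → ℝ, ContDiffOn ℝ 2 φ Ω → TouchesAbove φ u x →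
    0 ≤ F x (u x) (gradient φ x) (hessian φ x)

/-- The comparison principle for `F` in `Ω`, between a classical supersolution and a continuous
viscosity subsolution. -/
def ComparisonPrinciple (F : Operator n) (Ω : Set (Eu n)) : Prop :=
  ∀ u v : Eu n → ℝ, IsClassicalSupersolution F Ω u →
    ContinuousOn v (closure Ω) → IsViscositySubsolution F Ω v →
    (∀ x ∈ frontier Ω, v x ≤ u x) → ∀ x ∈ Ω, v x ≤ u x

/-- `ν` is an inward direction of the open convex set `Ω` at `x`. -/
def IsInwardDirection (Ω : Set (Eu n)) (x ν : Eu n) : Prop :=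
  ∃ t : ℝ, 0 < t ∧ x + t • ν ∈ Ω

/-- `liminf_{y → x, y ∈ Ω} ∂u(y)/∂ν > 0` for every `x ∈ ∂Ω` and every inward direction `ν`
(the lower limit may be `+∞`). -/
def HasPositiveInwardSlope (Ω : Set (Eu n)) (u : Eu n → ℝ) : Prop :=
  ∀ x ∈ frontier Ω, ∀ ν : Eu n, IsInwardDirection Ω x ν →
    ∃ ε : ℝ, 0 < ε ∧ ∀ᶠ y in 𝓝[Ω] x, ε ≤ fderiv ℝ u y ν

/-! ### Mean width -/

/-- The support function `h(Ω, X) = max_{y ∈ Ω̄} ⟨X, y⟩`. -/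
def supportFun (Ω : Set (Eu n)) (X : Eu n) : ℝ :=
  sSup ((fun y => inner ℝ X y) '' closure Ω)

/-- The mean width `w(Ω) = (n ωₙ)⁻¹ ∫_{S^{n-1}} (h(Ω, ξ) + h(Ω, -ξ)) dξ`. -/
def meanWidth (Ω : Set (Eu n)) : ℝ :=
  (1 / (n * volume.real (ball (0 : Eu n) 1))) *
    ∫ ξ : sphere (0 : Eu n) 1,
      (supportFun Ω (ξ : Eu n) + supportFun Ω (-(ξ : Eu n)))
        ∂(volume : Measure (Eu n)).toSphere

/-! ### The rearrangement -/

/-- The weighted `p`-mean `(∑ μᵢ aᵢ^p)^{1/p}` of nonnegative numbers, for `p > 0`. -/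
def pMean {m : ℕ} (p : ℝ) (μ a : Fin m → ℝ) : ℝ :=
  (∑ i, μ i * a i ^ p) ^ (1 / p)

/-- The `(p, μ)`-convolution of `u₁, …, u_m`, defined on the closures of `Ω₁, …, Ω_m`.
At a point outside `∑ μᵢ Ω̄ᵢ` the set is empty and the value is `0`, which is the extension by
zero. -/
def pConvolution {m : ℕ} (p : ℝ) (μ : Fin m → ℝ) (Ω : Fin m → Set (Eu n))
    (u : Fin m → Eu n → ℝ) (x : Eu n) : ℝ :=
  sSup {s | ∃ y : Fin m → Eu n, (∀ i, y i ∈ closure (Ω i)) ∧ x = ∑ i, μ i • y i ∧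
    s = pMean p μ fun i => u i (y i)}

/-- The rotation mean `m⁻¹ (ρ₁ Ω + ⋯ + ρ_m Ω)` (Minkowski sum). -/
def rotationMean (Ω : Set (Eu n)) (ρ : ℕ → Rot n) (m : ℕ) : Set (Eu n) :=
  (1 / (m : ℝ)) • ∑ i : Fin m, rot (ρ i) '' Ω

/-- The rotated copy `u_ρ(x) = u(ρ⁻¹ x)`. -/
def rotateFun (ρ : Rot n) (u : Eu n → ℝ) (x : Eu n) : ℝ := u (rot ρ⁻¹ x)

/-- The `(p, (1/m, …, 1/m))`-mean of the rotated copies `u_{ρ₁}, …, u_{ρ_m}`, extended by zero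
outside the closure of the rotation mean. -/
def rotationMeanFun (p : ℝ) (Ω : Set (Eu n)) (u : Eu n → ℝ) (ρ : ℕ → Rot n) (m : ℕ) :
    Eu n → ℝ :=
  pConvolution p (fun _ : Fin m => 1 / (m : ℝ)) (fun i => rot (ρ i) '' Ω)
    (fun i => rotateFun (ρ i) u)

/-- The open ball with centre `c` whose diameter is the mean width of `Ω`. -/
def sharpBall (Ω : Set (Eu n)) (c : Eu n) : Set (Eu n) := ball c (meanWidth Ω / 2)

/-- The rotation means of `Ω` along `ρ` converge, in the Hausdorff metric, to the ball with centre
`c` and the same mean width as `Ω`. -/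
def IsSymmetrizing (Ω : Set (Eu n)) (ρ : ℕ → Rot n) (c : Eu n) : Prop :=
  Tendsto (fun m => hausdorffEDist (rotationMean Ω ρ m) (sharpBall Ω c)) atTop (𝓝 0)

/-- `U` is a mean width rearrangement `u_p^♯` of `u` along `ρ`: a uniform limit, on the closed ball,
of a subsequence of the `p`-means of the rotated copies of `u`. -/
def IsRearrangement (p : ℝ) (Ω : Set (Eu n)) (u : Eu n → ℝ) (ρ : ℕ → Rot n) (c : Eu n)
    (U : Eu n → ℝ) : Prop :=
  ∃ φ : ℕ → ℕ, StrictMono φ ∧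
    TendstoUniformlyOn (fun k => rotationMeanFun p Ω u ρ (φ k)) U atTop (closure (sharpBall Ω c))

end MeanWidth

end

/-! Everything rests on the claim that each rotation mean is a viscosity subsolution in the interior
of its own domain. At a point `x` the supremum is attained by some `yᵢ` in the closure of `Ω`, and
`x` is the mean of the `ρᵢ yᵢ`. No `yᵢ` lies on the boundary: by the slope hypothesis a boundary
component pushed inward by `s` gains at least order `s ^ p`, while the others lose only order `s`,
and `p < 1` (`mem_of_rotationMeanFun_eq`).

Let a smooth `φ` touch the mean from above at `x`, with value `b`. Then the mean of `u(yᵢ + ηᵢ) ^ p`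
minus the `p`-th power of `φ`, shifted to equal `b` at `x`, has a local maximum at `η = 0` along
every line (`jet_conditions`). To first order, all vectors `u(yᵢ) ^ (p - 1) • ρᵢ Du(yᵢ)` equal one
`θ = b ^ (p - 1) • Dφ(x)`. To second order, along `ηᵢ = (u(yᵢ) / b) ^ p • ρᵢ⁻¹ ζ`, the squared
gradient terms cancel and `D²φ(x)` dominates `b ^ (1 - 3p)` times the mean of `Aᵢ = u(yᵢ) ^ (3p - 1)
• ρᵢ D²u(yᵢ) ρᵢᵀ`. By the equation and rotation invariance, `(ρᵢ yᵢ, u(yᵢ) ^ p, Aᵢ)` lies in the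
convex superlevel set for `θ`. So does the mean of these triples, and ellipticity gives the
inequality for `φ` (`rotationMeanFun_subsolution`).

Viscosity subsolutions survive uniform limits. A rearrangement is therefore a subsolution in the
ball, nonpositive on the sphere, and the comparison principle gives (1).

For (2), the rotation mean of the compact set `{u ≥ s}` has at least the volume of that set, by
Brunn–Minkowski, and the mean function is at least `s` on it. In the limit the distribution function
of `u` is bounded by that of `v`, and the layer cake formula turns this into norms.

For (0), independent Haar-distributed rotations and the strong law in `C(S, ℝ)` make the support
functions of the means converge uniformly to the constant half mean width. Rearrangements exist by
Arzelà–Ascoli, because the means are bounded and equicontinuous uniformly in `ρ` and `m`. -/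

namespace MeanWidth

section

variable {n : ℕ}

/-! ### Rotations -/

lemma coe_inv_rot (ρ : Rot n) : ((ρ⁻¹ : Rot n) : Mat n) = (ρ : Mat n).transpose := rfl

lemma rot_mul (ρ σ : Rot n) (x : Eu n) : rot (ρ * σ) x = rot ρ (rot σ x) := by
  simp [rot, Matrix.toLpLin_apply, Matrix.mulVec_mulVec]

lemma rot_one (x : Eu n) : rot (1 : Rot n) x = x := by
  simp [rot]

@[simp] lemma rot_inv_rot (ρ : Rot n) (x : Eu n) : rot ρ⁻¹ (rot ρ x) = x := by
  rw [← rot_mul, inv_mul_cancel, rot_one]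

@[simp] lemma rot_rot_inv (ρ : Rot n) (x : Eu n) : rot ρ (rot ρ⁻¹ x) = x := by
  rw [← rot_mul, mul_inv_cancel, rot_one]

lemma inner_rot_left (ρ : Rot n) (x y : Eu n) : inner ℝ (rot ρ x) y = inner ℝ x (rot ρ⁻¹ y) := by
  simp only [rot, coe_inv_rot, Matrix.toLpLin_apply, EuclideanSpace.inner_eq_star_dotProduct,
    star_trivial]
  rw [Matrix.mulVec_transpose, ← Matrix.dotProduct_mulVec]

lemma inner_rot_right (ρ : Rot n) (x y : Eu n) :
    inner ℝ x (rot ρ y) = inner ℝ (rot ρ⁻¹ x) y := by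
  rw [inner_rot_left, inv_inv]

lemma norm_rot (ρ : Rot n) (x : Eu n) : ‖rot ρ x‖ = ‖x‖ := by
  have h : inner ℝ (rot ρ x) (rot ρ x) = inner ℝ x x := by rw [inner_rot_left, rot_inv_rot]
  rw [real_inner_self_eq_norm_sq, real_inner_self_eq_norm_sq] at h
  exact (sq_eq_sq₀ (norm_nonneg _) (norm_nonneg _)).1 h

/-- A rotation as a linear isometric equivalence. -/
noncomputable def rotEquiv (ρ : Rot n) : Eu n ≃ₗᵢ[ℝ] Eu n where
  toLinearEquiv := LinearEquiv.ofLinearMap (Matrix.toEuclideanLin (ρ : Mat n))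
    (Matrix.toEuclideanLin ((ρ⁻¹ : Rot n) : Mat n))
    (LinearMap.ext fun x => rot_rot_inv ρ x) (LinearMap.ext fun x => rot_inv_rot ρ x)
  norm_map' := norm_rot ρ

@[simp] lemma coe_rotEquiv (ρ : Rot n) : ⇑(rotEquiv ρ) = rot ρ := rfl

lemma rot_neg (ρ : Rot n) (x : Eu n) : rot ρ (-x) = -rot ρ x :=
  map_neg (rotEquiv ρ) x

lemma rot_smul (ρ : Rot n) (a : ℝ) (x : Eu n) : rot ρ (a • x) = a • rot ρ x :=
  (rotEquiv ρ).map_smul a x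

lemma isometry_rot (ρ : Rot n) : Isometry (rot ρ) := (rotEquiv ρ).isometry

lemma continuous_rot (ρ : Rot n) : Continuous (rot ρ) := (isometry_rot ρ).continuous

lemma closure_rot_image (ρ : Rot n) (S : Set (Eu n)) :
    closure (rot ρ '' S) = rot ρ '' closure S :=
  ((rotEquiv ρ).toHomeomorph.image_closure S).symm

lemma volume_rot_image (ρ : Rot n) (S : Set (Eu n)) : volume (rot ρ '' S) = volume S := by
  have h := (rotEquiv ρ).symm.measurePreserving.measure_preimage_emb
    (rotEquiv ρ).symm.toHomeomorph.measurableEmbedding S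
  rw [← h]
  congr 1
  exact (rotEquiv ρ).toEquiv.image_eq_preimage_symm S

/-- The Householder reflection in direction `v`. -/
def householder (v : Fin n → ℝ) : Mat n :=
  1 + Matrix.replicateCol Unit (-(2 : ℝ) • v) * Matrix.replicateRow Unit v

lemma householder_mulVec (v x : Fin n → ℝ) :
    (householder v).mulVec x = x - (2 * (v ⬝ᵥ x)) • v := by
  ext i
  simp only [householder, Matrix.add_mulVec, Matrix.one_mulVec, Pi.add_apply, Pi.sub_apply,
    Pi.smul_apply, smul_eq_mul]
  simp only [Matrix.mulVec, dotProduct, Matrix.mul_apply, Matrix.replicateCol_apply,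
    Matrix.replicateRow_apply, Finset.univ_unique, Finset.sum_singleton, Pi.smul_apply,
    smul_eq_mul, Finset.mul_sum, Finset.sum_mul]
  rw [sub_eq_add_neg, ← Finset.sum_neg_distrib]
  congr 1
  exact Finset.sum_congr rfl fun j _ => by ring

lemma householder_transpose (v : Fin n → ℝ) : (householder v).transpose = householder v := by
  ext i j
  simp [householder, Matrix.mul_apply, Matrix.one_apply, eq_comm]
  ring

lemma householder_mul_self {v : Fin n → ℝ} (hv : v ⬝ᵥ v = 1) :
    householder v * householder v = 1 := by
  apply Matrix.ext_of_mulVec_single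
  intro i
  rw [← Matrix.mulVec_mulVec, householder_mulVec, householder_mulVec]
  simp only [dotProduct_sub, dotProduct_smul, hv, Matrix.one_mulVec, smul_eq_mul]
  module

lemma det_householder {v : Fin n → ℝ} (hv : v ⬝ᵥ v = 1) : (householder v).det = -1 := by
  rw [householder, Matrix.det_one_add_replicateCol_mul_replicateRow]
  simp only [dotProduct_smul, hv, smul_eq_mul]
  norm_num

/-- The rotation obtained by composing two Householder reflections. -/
def householderRot (v w : Fin n → ℝ) (hv : v ⬝ᵥ v = 1) (hw : w ⬝ᵥ w = 1) : Rot n :=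
  ⟨householder w * householder v, Matrix.mem_specialOrthogonalGroup_iff.2
    ⟨(Matrix.mem_orthogonalGroup_iff _ _).2 (by
      rw [Matrix.transpose_mul, householder_transpose, householder_transpose, Matrix.mul_assoc,
        ← Matrix.mul_assoc (householder v), householder_mul_self hv, Matrix.one_mul,
        householder_mul_self hw]), by
      rw [Matrix.det_mul, det_householder hv, det_householder hw]; norm_num⟩⟩

lemma householderRot_apply (v w : Eu n) (hv : v.ofLp ⬝ᵥ v.ofLp = 1) (hw : w.ofLp ⬝ᵥ w.ofLp = 1)
    (x : Eu n) :
    rot (householderRot v.ofLp w.ofLp hv hw) x =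
      (x - (2 * inner ℝ v x) • v) - (2 * inner ℝ w (x - (2 * inner ℝ v x) • v)) • w := by
  have key : ∀ a b : Eu n, inner ℝ a b = a.ofLp ⬝ᵥ b.ofLp := by
    intro a b
    rw [EuclideanSpace.inner_eq_star_dotProduct, star_trivial, dotProduct_comm]
  ext i
  simp only [rot, Matrix.toLpLin_apply, householderRot, ← Matrix.mulVec_mulVec, householder_mulVec,
    key]
  simp [dotProduct_sub]

/-- For `n ≥ 2` the rotation group acts transitively on the unit sphere. -/
lemma exists_rot_eq (hn : 2 ≤ n) {x y : Eu n} (hx : ‖x‖ = 1) (hy : ‖y‖ = 1) :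
    ∃ ρ : Rot n, rot ρ x = y := by
  have unit_dot : ∀ a : Eu n, ‖a‖ = 1 → a.ofLp ⬝ᵥ a.ofLp = 1 := by
    intro a ha
    have := real_inner_self_eq_norm_sq a
    rw [EuclideanSpace.inner_eq_star_dotProduct, star_trivial] at this
    rw [this, ha, one_pow]
  rcases eq_or_ne x y with rfl | hxy
  · exact ⟨1, rot_one x⟩
  -- Dimension at least two leaves room for `w` orthogonal to `y`: the reflection in `w` fixes `y`
  -- and restores determinant `1`.
  obtain ⟨w, hw, hwy⟩ : ∃ w : Eu n, ‖w‖ = 1 ∧ inner ℝ w y = 0 := by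
    have h1 : Module.finrank ℝ (Submodule.span ℝ {y}) < Module.finrank ℝ (Eu n) := by
      have := finrank_span_singleton (K := ℝ) (v := y) (by rintro rfl; simp at hy)
      rw [this, finrank_euclideanSpace_fin]; omega
    have h2 : (Submodule.span ℝ {y})ᗮ ≠ ⊥ := by
      intro h
      rw [Submodule.orthogonal_eq_bot_iff] at h
      rw [h, finrank_top] at h1
      exact lt_irrefl _ h1
    obtain ⟨w, hw, hw0⟩ := Submodule.exists_mem_ne_zero_of_ne_bot h2
    refine ⟨‖w‖⁻¹ • w, ?_, ?_⟩
    · rw [norm_smul, norm_inv, norm_norm, inv_mul_cancel₀ (norm_ne_zero_iff.2 hw0)]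
    · rw [inner_smul_left, Submodule.mem_orthogonal_singleton_iff_inner_left.1 hw, mul_zero]
  have hd : ‖x - y‖ ≠ 0 := norm_ne_zero_iff.2 (sub_ne_zero.2 hxy)
  set v : Eu n := ‖x - y‖⁻¹ • (x - y) with hv
  have hv1 : ‖v‖ = 1 := by
    rw [hv, norm_smul, norm_inv, norm_norm, inv_mul_cancel₀ hd]
  refine ⟨householderRot v.ofLp w.ofLp (unit_dot v hv1) (unit_dot w hw), ?_⟩
  -- The reflection in the direction `x - y` exchanges unit vectors `x` and `y`.
  have hrefl : x - (2 * inner ℝ v x) • v = y := by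
    have hxx : inner ℝ x x = (1 : ℝ) := by rw [real_inner_self_eq_norm_sq, hx, one_pow]
    have hsq : ‖x - y‖ ^ 2 = 2 * inner ℝ (x - y) x := by
      rw [norm_sub_sq_real, hx, hy, inner_sub_left, hxx, real_inner_comm]; ring
    have h3 : (2 * inner ℝ v x) • v = x - y := by
      rw [hv, inner_smul_left, smul_smul]
      simp only [RCLike.conj_to_real]
      have : 2 * (‖x - y‖⁻¹ * inner ℝ (x - y) x) * ‖x - y‖⁻¹ = 1 := by
        field_simp
        exact hsq.symm
      rw [this, one_smul]
    rw [h3]; abel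
  rw [householderRot_apply, hrefl, hwy, mul_zero, zero_smul, sub_zero]

end

section

variable {n : ℕ}

/-! ### Support functions and separation -/

lemma isCompact_closure_of_isBounded {Ω : Set (Eu n)} (hb : Bornology.IsBounded Ω) :
    IsCompact (closure Ω) :=
  Metric.isCompact_of_isClosed_isBounded isClosed_closure hb.closure

lemma inner_le_supportFun {Ω : Set (Eu n)} (hb : Bornology.IsBounded Ω) (ξ : Eu n) {y : Eu n}
    (hy : y ∈ closure Ω) : inner ℝ ξ y ≤ supportFun Ω ξ :=
  le_csSup ((isCompact_closure_of_isBounded hb).bddAbove_image (by fun_prop))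
    (mem_image_of_mem _ hy)

lemma exists_inner_eq_supportFun {Ω : Set (Eu n)} (hb : Bornology.IsBounded Ω)
    (hne : Ω.Nonempty) (ξ : Eu n) : ∃ y ∈ closure Ω, inner ℝ ξ y = supportFun Ω ξ := by
  obtain ⟨y, hy, h1, -⟩ := (isCompact_closure_of_isBounded hb).exists_sSup_image_eq_and_ge
    hne.closure (f := fun y => inner ℝ ξ y) (by fun_prop)
  exact ⟨y, hy, h1.symm⟩

/-- A supremum of linear functionals of norm at most `R` is `R`-Lipschitz. -/
lemma continuous_supportFun {Ω : Set (Eu n)} (hb : Bornology.IsBounded Ω) (hne : Ω.Nonempty) :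
    Continuous (supportFun Ω) := by
  obtain ⟨R, hR⟩ := hb.closure.exists_norm_le
  have hR0 : 0 ≤ R := (norm_nonneg _).trans (hR _ hne.closure.some_mem)
  refine (LipschitzWith.of_le_add_mul R.toNNReal fun ξ η => ?_).continuous
  obtain ⟨y, hy, h⟩ := exists_inner_eq_supportFun hb hne ξ
  rw [← h, Real.coe_toNNReal _ hR0, dist_eq_norm]
  have h1 : inner ℝ ξ y = inner ℝ η y + inner ℝ (ξ - η) y := by rw [inner_sub_left]; ring
  have h2 : inner ℝ (ξ - η) y ≤ ‖ξ - η‖ * ‖y‖ := real_inner_le_norm _ _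
  have h3 := inner_le_supportFun hb η hy
  nlinarith [hR y hy, norm_nonneg (ξ - η)]

/-- A point that no unit direction separates from a closed convex set belongs to it. -/
lemma mem_of_forall_exists_inner_le {K : Set (Eu n)} (hK : Convex ℝ K) (hc : IsClosed K)
    (hne : K.Nonempty) {x : Eu n}
    (h : ∀ ξ : Eu n, ‖ξ‖ = 1 → ∃ z ∈ K, inner ℝ ξ x ≤ inner ℝ ξ z) : x ∈ K := by
  by_contra hx
  obtain ⟨f, a, hf, ha⟩ := geometric_hahn_banach_closed_point hK hc hx
  set v := (InnerProductSpace.toDual ℝ (Eu n)).symm f with hv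
  have hfv : ∀ y, f y = inner ℝ v y := fun y => by
    rw [hv, InnerProductSpace.toDual_symm_apply]
  have hv0 : ‖v‖ ≠ 0 := by
    intro h0
    rw [norm_eq_zero] at h0
    obtain ⟨z, hz⟩ := hne
    have := (hf z hz).trans ha
    simp [hfv, h0] at this
  obtain ⟨z, hz, hle⟩ := h (‖v‖⁻¹ • v) (by
    rw [norm_smul, norm_inv, norm_norm, inv_mul_cancel₀ hv0])
  rw [inner_smul_left, inner_smul_left, RCLike.conj_to_real] at hle
  have h1 : inner ℝ v x ≤ inner ℝ v z :=
    le_of_mul_le_mul_left hle (inv_pos.2 (lt_of_le_of_ne (norm_nonneg v) hv0.symm))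
  have := hf z hz
  rw [hfv] at this ha
  linarith

/-! ### Rotation means of sets -/

/-- The map `(yᵢ) ↦ m⁻¹ ∑ ρᵢ yᵢ`. -/
noncomputable def meanMap (ρ : ℕ → Rot n) (m : ℕ) : (Fin m → Eu n) →L[ℝ] Eu n :=
  (1 / (m : ℝ)) • ∑ i : Fin m, ((rotEquiv (ρ i)).toContinuousLinearEquiv : Eu n →L[ℝ] Eu n).comp
    (ContinuousLinearMap.proj i)

lemma meanMap_apply (ρ : ℕ → Rot n) (m : ℕ) (y : Fin m → Eu n) :
    meanMap ρ m y = (1 / (m : ℝ)) • ∑ i : Fin m, rot (ρ i) (y i) := by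
  simp [meanMap]

lemma inner_meanMap (ρ : ℕ → Rot n) (m : ℕ) (ξ : Eu n) (y : Fin m → Eu n) :
    inner ℝ ξ (meanMap ρ m y) = (1 / (m : ℝ)) * ∑ i : Fin m, inner ℝ (rot (ρ i)⁻¹ ξ) (y i) := by
  rw [meanMap_apply, inner_smul_right, inner_sum]
  simp_rw [inner_rot_right]

lemma rotationMean_eq_image (Ω : Set (Eu n)) (ρ : ℕ → Rot n) (m : ℕ) :
    rotationMean Ω ρ m = meanMap ρ m '' univ.pi fun _ => Ω := by
  ext x
  simp only [rotationMean, mem_smul_set, mem_image, mem_univ_pi, meanMap_apply]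
  constructor
  · rintro ⟨z, hz, rfl⟩
    obtain ⟨g, hg, rfl⟩ := (Set.mem_fintype_sum _ _).1 hz
    choose y hy hyg using hg
    exact ⟨y, hy, by simp [hyg]⟩
  · rintro ⟨y, hy, rfl⟩
    exact ⟨_, (Set.mem_fintype_sum _ _).2 ⟨fun i => rot (ρ i) (y i),
      fun i => mem_image_of_mem _ (hy i), rfl⟩, rfl⟩

/-- The rotation mean of the closure of `Ω`. -/
noncomputable def closedMean (Ω : Set (Eu n)) (ρ : ℕ → Rot n) (m : ℕ) : Set (Eu n) :=
  meanMap ρ m '' univ.pi fun _ => closure Ω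

variable {Ω : Set (Eu n)} {ρ : ℕ → Rot n} {m : ℕ}

lemma rotationMean_subset_closedMean : rotationMean Ω ρ m ⊆ closedMean Ω ρ m := by
  rw [rotationMean_eq_image]
  exact image_mono (pi_mono fun _ _ => subset_closure)

lemma closedMean_subset_closure : closedMean Ω ρ m ⊆ closure (rotationMean Ω ρ m) := by
  rw [rotationMean_eq_image, closedMean, ← closure_pi_set]
  exact image_closure_subset_closure_image (meanMap ρ m).continuous

lemma isCompact_closedMean (hb : Bornology.IsBounded Ω) : IsCompact (closedMean Ω ρ m) :=
  (isCompact_univ_pi fun _ => isCompact_closure_of_isBounded hb).image (meanMap ρ m).continuous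

lemma convex_closedMean (hc : Convex ℝ Ω) : Convex ℝ (closedMean Ω ρ m) :=
  (convex_pi fun _ _ => hc.closure).linear_image (meanMap ρ m).toLinearMap

lemma convex_rotationMean (hc : Convex ℝ Ω) : Convex ℝ (rotationMean Ω ρ m) := by
  rw [rotationMean_eq_image]
  exact (convex_pi fun _ _ => hc).linear_image (meanMap ρ m).toLinearMap

lemma rotationMean_nonempty (hne : Ω.Nonempty) : (rotationMean Ω ρ m).Nonempty := by
  rw [rotationMean_eq_image]
  exact (univ_pi_nonempty_iff.2 fun _ => hne).image _

lemma closure_rotationMean (hb : Bornology.IsBounded Ω) :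
    closure (rotationMean Ω ρ m) = closedMean Ω ρ m :=
  (closure_minimal rotationMean_subset_closedMean (isCompact_closedMean hb).isClosed).antisymm
    closedMean_subset_closure

/-- `meanMap` is onto, since `x` is the image of the tuple `ρᵢ⁻¹ x`; a surjective linear map in
finite dimension is open. -/
lemma isOpen_rotationMean (hm : 0 < m) (ho : IsOpen Ω) : IsOpen (rotationMean Ω ρ m) := by
  rw [rotationMean_eq_image]
  refine (meanMap ρ m).isOpenMap (fun x => ⟨fun i => rot (ρ i)⁻¹ x, ?_⟩) _
    (isOpen_set_pi finite_univ fun _ _ => ho)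
  have : (m : ℝ) ≠ 0 := by positivity
  rw [meanMap_apply]
  simp only [rot_rot_inv, Finset.sum_const, Finset.card_univ, Fintype.card_fin]
  rw [← Nat.cast_smul_eq_nsmul ℝ, smul_smul, one_div, inv_mul_cancel₀ this, one_smul]

/-- An open convex set is the interior of its closure. -/
lemma mem_rotationMean_of_ball_subset (hm : 0 < m) (ho : IsOpen Ω) (hb : Bornology.IsBounded Ω)
    (hc : Convex ℝ Ω) (hne : Ω.Nonempty) {x : Eu n} {η : ℝ} (hη : 0 < η)
    (h : ball x η ⊆ closedMean Ω ρ m) : x ∈ rotationMean Ω ρ m := by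
  have hop := isOpen_rotationMean (ρ := ρ) hm ho
  have h1 : x ∈ interior (closure (rotationMean Ω ρ m)) := by
    rw [closure_rotationMean hb]
    exact mem_interior.2 ⟨_, h, isOpen_ball, mem_ball_self hη⟩
  rwa [(convex_rotationMean hc).interior_closure_eq_interior_of_nonempty_interior
    (by rw [hop.interior_eq]; exact rotationMean_nonempty hne), hop.interior_eq] at h1

/-- The support function of the rotation mean. -/
noncomputable def meanSupport (Ω : Set (Eu n)) (ρ : ℕ → Rot n) (m : ℕ) (ξ : Eu n) : ℝ :=
  (1 / (m : ℝ)) * ∑ i : Fin m, supportFun Ω (rot (ρ i)⁻¹ ξ)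

lemma inner_le_meanSupport (hb : Bornology.IsBounded Ω) (ξ : Eu n) {x : Eu n}
    (hx : x ∈ closedMean Ω ρ m) : inner ℝ ξ x ≤ meanSupport Ω ρ m ξ := by
  obtain ⟨y, hy, rfl⟩ := hx
  rw [inner_meanMap, meanSupport]
  exact mul_le_mul_of_nonneg_left (Finset.sum_le_sum fun i _ =>
    inner_le_supportFun hb _ (hy i (mem_univ i))) (by positivity)

lemma exists_inner_eq_meanSupport (hb : Bornology.IsBounded Ω) (hne : Ω.Nonempty) (ξ : Eu n) :
    ∃ x ∈ closedMean Ω ρ m, inner ℝ ξ x = meanSupport Ω ρ m ξ := by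
  choose y hy h using fun i : Fin m => exists_inner_eq_supportFun hb hne (rot (ρ i)⁻¹ ξ)
  exact ⟨_, ⟨y, fun i _ => hy i, rfl⟩, by rw [inner_meanMap, meanSupport]; simp_rw [h]⟩

/-- Uniform closeness of the support functions bounds the Hausdorff distance to a ball. -/
lemma hausdorffEDist_rotationMean_ball_le (hb : Bornology.IsBounded Ω)
    (hc : Convex ℝ Ω) (hne : Ω.Nonempty) {r ε : ℝ} (hε : 0 < ε) (hεr : ε < r)
    (h : ∀ ξ : Eu n, ‖ξ‖ = 1 → |meanSupport Ω ρ m ξ - r| ≤ ε) :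
    hausdorffEDist (rotationMean Ω ρ m) (ball 0 r) ≤ ENNReal.ofReal (2 * ε) := by
  rw [← hausdorffEDist_closure, closure_rotationMean hb, closure_ball _ (by linarith)]
  -- Shrinking radially to radius `r - ε` moves points of norm at most `r + ε` by at most `2ε`. It
  -- serves both directions, as the ball of radius `r - ε` lies in the mean and in the limit ball.
  have scale : ∀ x : Eu n, ‖x‖ ≤ r + ε → ∃ t : ℝ, ‖t • x‖ ≤ r - ε ∧ dist x (t • x) ≤ 2 * ε := by
    intro x hx
    by_cases hxs : ‖x‖ ≤ r - ε
    · exact ⟨1, by simpa using hxs, by simp; positivity⟩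
    · have hx0 : 0 < ‖x‖ := by linarith
      refine ⟨(r - ε) / ‖x‖, ?_, ?_⟩
      · rw [norm_smul, Real.norm_of_nonneg (div_nonneg (by linarith) hx0.le),
          div_mul_cancel₀ _ hx0.ne']
      · have h1 : x - ((r - ε) / ‖x‖) • x = (1 - (r - ε) / ‖x‖) • x := by
          rw [sub_smul, one_smul]
        have h2 : 0 ≤ 1 - (r - ε) / ‖x‖ := by
          rw [sub_nonneg, div_le_one hx0]; linarith
        rw [dist_eq_norm, h1, norm_smul, Real.norm_of_nonneg h2, sub_mul,
          div_mul_cancel₀ _ hx0.ne']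
        linarith
  have inner_sub : closedBall (0 : Eu n) (r - ε) ⊆ closedMean Ω ρ m := by
    intro x hx
    refine mem_of_forall_exists_inner_le (convex_closedMean hc) (isCompact_closedMean hb).isClosed
      ((rotationMean_nonempty hne).mono rotationMean_subset_closedMean) fun ξ hξ => ?_
    obtain ⟨z, hz, hzξ⟩ := exists_inner_eq_meanSupport (ρ := ρ) (m := m) hb hne ξ
    refine ⟨z, hz, ?_⟩
    have h1 := real_inner_le_norm ξ x
    have h2 := (abs_le.1 (h ξ hξ)).1
    rw [hξ, one_mul] at h1
    rw [mem_closedBall_zero_iff] at hx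
    linarith
  refine hausdorffEDist_le_of_mem_edist (fun x hx => ?_) fun x hx => ?_
  · have hx1 : ‖x‖ ≤ r + ε := by
      rcases eq_or_ne x 0 with rfl | hx0
      · simp; linarith
      · have hx0' := norm_ne_zero_iff.2 hx0
        have hu : ‖‖x‖⁻¹ • x‖ = 1 := by
          rw [norm_smul, norm_inv, norm_norm, inv_mul_cancel₀ hx0']
        have h1 := inner_le_meanSupport hb (‖x‖⁻¹ • x) hx
        rw [inner_smul_left, RCLike.conj_to_real, real_inner_self_eq_norm_sq, sq,
          inv_mul_cancel_left₀ hx0'] at h1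
        linarith [(abs_le.1 (h _ hu)).2]
    obtain ⟨t, ht, hd⟩ := scale x hx1
    refine ⟨t • x, by rw [mem_closedBall_zero_iff]; linarith, ?_⟩
    rw [edist_dist]
    exact ENNReal.ofReal_le_ofReal hd
  · rw [mem_closedBall_zero_iff] at hx
    obtain ⟨t, ht, hd⟩ := scale x (by linarith)
    refine ⟨t • x, inner_sub (by rwa [mem_closedBall_zero_iff]), ?_⟩
    rw [edist_dist]
    exact ENNReal.ofReal_le_ofReal hd

end

section

variable {n : ℕ}

/-! ### Existence of symmetrizing sequences -/

instance : ContinuousInv (Rot n) where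
  continuous_inv := Continuous.subtype_mk
    (Continuous.matrix_transpose continuous_subtype_val) _

instance : IsTopologicalGroup (Rot n) where

instance : CompactSpace (Rot n) := by
  suffices IsCompact {A : Mat n | A ∈ Matrix.specialOrthogonalGroup (Fin n) ℝ} from
    isCompact_iff_compactSpace.1 this
  have hK : IsCompact {A : Mat n | ∀ i j, A i j ∈ Icc (-1 : ℝ) 1} := by
    have : {A : Mat n | ∀ i j, A i j ∈ Icc (-1 : ℝ) 1} =
        (univ.pi fun _ => univ.pi fun _ => Icc (-1 : ℝ) 1 : Set (Fin n → Fin n → ℝ)) := by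
      ext A
      exact ⟨fun h i _ j _ => h i j, fun h i j => h i trivial j trivial⟩
    rw [this]
    exact isCompact_univ_pi fun _ => isCompact_univ_pi fun _ => isCompact_Icc
  refine hK.of_isClosed_subset ?_ fun A hA i j => ?_
  · have : {A : Mat n | A ∈ Matrix.specialOrthogonalGroup (Fin n) ℝ} =
        {A : Mat n | A * A.transpose = 1} ∩ {A : Mat n | A.det = 1} := by
      ext A
      rw [mem_ofPred_eq, Matrix.mem_specialOrthogonalGroup_iff, Matrix.mem_orthogonalGroup_iff]
      rfl
    exact this ▸ (isClosed_eq (by fun_prop) continuous_const).inter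
      (isClosed_eq (by fun_prop) continuous_const)
  · have h1 : (A * A.transpose) i i = 1 := by
      rw [(Matrix.mem_orthogonalGroup_iff _ _).1 (Matrix.mem_specialOrthogonalGroup_iff.1 hA).1,
        Matrix.one_apply_eq]
    rw [Matrix.mul_apply] at h1
    have h2 : A i j * A i j ≤ ∑ k, A i k * A.transpose k i :=
      Finset.single_le_sum (f := fun k => A i k * A.transpose k i)
        (fun k _ => mul_self_nonneg _) (Finset.mem_univ j)
    exact abs_le.1 (abs_le_one_iff_mul_self_le_one.2 (h2.trans h1.le))

instance : MeasurableSpace (Rot n) := borel _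

instance : BorelSpace (Rot n) := ⟨rfl⟩

/-- The normalized Haar measure of the rotation group. -/
noncomputable def haarRot (n : ℕ) : Measure (Rot n) := Measure.haarMeasure ⊤

instance : IsProbabilityMeasure (haarRot n) := by
  refine ⟨?_⟩
  have := Measure.haarMeasure_self (K₀ := (⊤ : TopologicalSpace.PositiveCompacts (Rot n)))
  rwa [TopologicalSpace.PositiveCompacts.coe_top] at this

instance : (haarRot n).IsMulLeftInvariant :=
  inferInstanceAs (Measure.haarMeasure ⊤).IsMulLeftInvariant

lemma continuous_rot_uncurry : Continuous fun q : Rot n × Eu n => rot q.1 q.2 := by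
  have : (fun q : Rot n × Eu n => rot q.1 q.2) =
      fun q => WithLp.toLp 2 ((q.1 : Mat n).mulVec q.2.ofLp) := by
    ext q; simp [rot, Matrix.toLpLin_apply]
  rw [this]
  fun_prop

/-- The action of a rotation on the unit sphere. -/
noncomputable def rotSphere (ρ : Rot n) (ξ : sphere (0 : Eu n) 1) : sphere (0 : Eu n) 1 :=
  ⟨rot ρ ξ, by rw [mem_sphere_zero_iff_norm, norm_rot, norm_eq_of_mem_sphere]⟩

lemma continuous_rotSphere {X : Type*} [TopologicalSpace X] {f : X → Rot n}
    {g : X → sphere (0 : Eu n) 1} (hf : Continuous f) (hg : Continuous g) :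
    Continuous fun x => rotSphere (f x) (g x) := by
  have h : Continuous fun x => (f x, (g x : Eu n)) :=
    hf.prodMk (continuous_subtype_val.comp hg)
  exact (continuous_rot_uncurry.comp h).subtype_mk _

/-- The rotations of the sphere as homeomorphisms. -/
noncomputable def rotSphereHomeomorph (ρ : Rot n) :
    sphere (0 : Eu n) 1 ≃ₜ sphere (0 : Eu n) 1 where
  toFun := rotSphere ρ
  invFun := rotSphere ρ⁻¹
  left_inv ξ := Subtype.ext (rot_inv_rot ρ ξ)
  right_inv ξ := Subtype.ext (rot_rot_inv ρ ξ)
  continuous_toFun := continuous_rotSphere continuous_const continuous_id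
  continuous_invFun := continuous_rotSphere continuous_const continuous_id

/-- The surface measure of a set is a multiple of the volume of the cone over it, and taking cones
commutes with rotations. -/
lemma measurePreserving_rotSphere (ρ : Rot n) :
    MeasurePreserving (rotSphere ρ) (volume : Measure (Eu n)).toSphere
      (volume : Measure (Eu n)).toSphere := by
  refine ⟨(rotSphereHomeomorph ρ).measurable, ?_⟩
  ext s hs
  have hmeas : Measurable (rotSphere ρ) := (rotSphereHomeomorph ρ).measurable
  rw [Measure.map_apply hmeas hs, Measure.toSphere_apply' _ hs,
    Measure.toSphere_apply' _ (hmeas hs)]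
  congr 1
  have hset : Ioo (0 : ℝ) 1 • ((↑) '' s : Set (Eu n)) =
      rot ρ '' (Ioo (0 : ℝ) 1 • ((↑) '' (rotSphere ρ ⁻¹' s) : Set (Eu n))) := by
    ext x
    simp only [Set.mem_smul, mem_image, mem_preimage]
    constructor
    · rintro ⟨t, ht, _, ⟨ξ, hξ, rfl⟩, rfl⟩
      refine ⟨t • rot ρ⁻¹ ξ, ⟨t, ht, _, ⟨rotSphere ρ⁻¹ ξ, ?_, rfl⟩, rfl⟩, ?_⟩
      · rwa [show rotSphere ρ (rotSphere ρ⁻¹ ξ) = ξ from Subtype.ext (rot_rot_inv ρ ξ)]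
      · rw [rot_smul, rot_rot_inv]
    · rintro ⟨_, ⟨t, ht, _, ⟨ξ, hξ, rfl⟩, rfl⟩, rfl⟩
      exact ⟨t, ht, _, ⟨_, hξ, rfl⟩, (rot_smul ρ t ξ).symm⟩
  rw [hset, volume_rot_image]

/-- Averaging a continuous function over the rotation group gives its mean over the sphere. -/
lemma integral_rotSphere_inv (hn : 2 ≤ n) {f : sphere (0 : Eu n) 1 → ℝ} (hf : Continuous f)
    (ξ : sphere (0 : Eu n) 1) :
    ∫ ρ, f (rotSphere ρ⁻¹ ξ) ∂(haarRot n) =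
      (1 / (n * volume.real (ball (0 : Eu n) 1))) *
        ∫ η, f η ∂(volume : Measure (Eu n)).toSphere := by
  set σ := (volume : Measure (Eu n)).toSphere with hσ
  -- The average does not depend on the point: a rotation `τ` taking `ξ` to `η` is absorbed by left
  -- invariance of Haar measure.
  have hconst : ∀ η : sphere (0 : Eu n) 1,
      ∫ ρ, f (rotSphere ρ⁻¹ η) ∂(haarRot n) = ∫ ρ, f (rotSphere ρ⁻¹ ξ) ∂(haarRot n) := by
    intro η
    obtain ⟨τ, hτ⟩ := exists_rot_eq hn (norm_eq_of_mem_sphere ξ) (norm_eq_of_mem_sphere η)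
    rw [← integral_mul_left_eq_self (fun ρ => f (rotSphere ρ⁻¹ η)) τ]
    congr 1
    ext ρ
    congr 1
    apply Subtype.ext
    change rot (τ * ρ)⁻¹ η = rot ρ⁻¹ ξ
    rw [mul_inv_rev, rot_mul, ← hτ, rot_inv_rot]
  have hcont : Continuous (Function.uncurry fun (η : sphere (0 : Eu n) 1) (ρ : Rot n) =>
      f (rotSphere ρ⁻¹ η)) :=
    hf.comp (continuous_rotSphere continuous_snd.inv continuous_fst)
  have hint : Integrable (Function.uncurry fun (η : sphere (0 : Eu n) 1) (ρ : Rot n) =>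
      f (rotSphere ρ⁻¹ η)) (σ.prod (haarRot n)) :=
    hcont.integrable_of_hasCompactSupport (HasCompactSupport.of_compactSpace _)
  -- Integrating the constant average over the sphere and swapping the integrals leaves the surface
  -- integral of `f`, by rotation invariance of the surface measure.
  have hfub := integral_integral_swap hint
  simp_rw [hconst] at hfub
  have hinv : ∀ ρ : Rot n, ∫ η, f (rotSphere ρ⁻¹ η) ∂σ = ∫ η, f η ∂σ := fun ρ =>
    (measurePreserving_rotSphere ρ⁻¹).integral_comp
      (rotSphereHomeomorph ρ⁻¹).measurableEmbedding f
  simp_rw [hinv] at hfub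
  rw [integral_const, integral_const, probReal_univ (μ := haarRot n), one_smul, smul_eq_mul, hσ,
    Measure.toSphere_real_apply_univ, finrank_euclideanSpace_fin] at hfub
  have hpos : 0 < n * volume.real (ball (0 : Eu n) 1) := by
    have h1 : 0 < volume.real (ball (0 : Eu n) 1) :=
      ENNReal.toReal_pos (measure_ball_pos _ _ one_pos).ne' measure_ball_lt_top.ne
    have h2 : (0 : ℝ) < n := by exact_mod_cast (by omega : 0 < n)
    positivity
  rw [← hfub, ← mul_assoc, one_div_mul_cancel hpos.ne', one_mul]

/-- The rotation average has the same value at `ξ` and `-ξ`, so the two terms of the mean width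
contribute equally. -/
lemma integral_supportFun_rot (Ω : Set (Eu n)) (hn : 2 ≤ n) (hb : Bornology.IsBounded Ω)
    (hne : Ω.Nonempty) (ξ : sphere (0 : Eu n) 1) :
    ∫ ρ, supportFun Ω (rot ρ⁻¹ ξ) ∂(haarRot n) = meanWidth Ω / 2 := by
  have hc := continuous_supportFun hb hne
  have h1 := integral_rotSphere_inv hn
    (f := fun η : sphere (0 : Eu n) 1 => supportFun Ω η) (hc.comp continuous_subtype_val) ξ
  have h2 := integral_rotSphere_inv hn
    (f := fun η : sphere (0 : Eu n) 1 => supportFun Ω (-(η : Eu n)))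
    (hc.comp continuous_subtype_val.neg) ξ
  have h3 := integral_rotSphere_inv hn
    (f := fun η : sphere (0 : Eu n) 1 => supportFun Ω η) (hc.comp continuous_subtype_val) (-ξ)
  have h4 : ∀ ρ : Rot n, -((rotSphere ρ⁻¹ ξ : sphere (0 : Eu n) 1) : Eu n) =
      (rotSphere ρ⁻¹ (-ξ) : sphere (0 : Eu n) 1) := fun ρ => (rot_neg ρ⁻¹ ξ).symm
  simp_rw [h4] at h2
  have hI : ∀ g : Eu n → ℝ, Continuous g → Integrable (fun η : sphere (0 : Eu n) 1 => g η)
      (volume : Measure (Eu n)).toSphere := fun g hg =>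
    (hg.comp continuous_subtype_val).integrable_of_hasCompactSupport
      (HasCompactSupport.of_compactSpace _)
  have h5 : meanWidth Ω = ∫ ρ, supportFun Ω (rotSphere ρ⁻¹ ξ : sphere (0 : Eu n) 1) ∂(haarRot n) +
      ∫ ρ, supportFun Ω (rotSphere ρ⁻¹ (-ξ) : sphere (0 : Eu n) 1) ∂(haarRot n) := by
    rw [h1, h2, ← mul_add, ← integral_add (hI _ hc) (hI (fun η => supportFun Ω (-η))
      (hc.comp continuous_neg)), meanWidth]
  have h6 : ∫ ρ, supportFun Ω (rot ρ⁻¹ ξ) ∂(haarRot n) =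
    ∫ ρ, supportFun Ω (rotSphere ρ⁻¹ ξ : sphere (0 : Eu n) 1) ∂(haarRot n) := rfl
  rw [h6, h5, h3, h1]
  ring

/-- The mean width of a set containing a ball. -/
lemma meanWidth_pos (hn : 2 ≤ n) {Ω : Set (Eu n)} (ho : IsOpen Ω) (hb : Bornology.IsBounded Ω)
    (hne : Ω.Nonempty) : 0 < meanWidth Ω := by
  obtain ⟨x, hx⟩ := hne
  obtain ⟨r, hr, hball⟩ := Metric.isOpen_iff.1 ho x hx
  -- The points `x ± (r/2) ξ` of `Ω` make the width at least `r` in every direction.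
  have hpos : ∀ ξ : sphere (0 : Eu n) 1, r ≤ supportFun Ω ξ + supportFun Ω (-(ξ : Eu n)) := by
    intro ξ
    have hn1 := norm_eq_of_mem_sphere ξ
    have hxi : inner ℝ (ξ : Eu n) (ξ : Eu n) = (1 : ℝ) := by
      rw [real_inner_self_eq_norm_sq, hn1, one_pow]
    have hy : x + (r / 2) • (ξ : Eu n) ∈ Ω := hball (by
      rw [mem_ball, dist_self_add_left, norm_smul, hn1, mul_one, Real.norm_of_nonneg (by linarith)]
      linarith)
    have hz : x - (r / 2) • (ξ : Eu n) ∈ Ω := hball (by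
      rw [mem_ball, dist_self_sub_left, norm_smul, hn1, mul_one, Real.norm_of_nonneg (by linarith)]
      linarith)
    have h1 := inner_le_supportFun hb ξ (subset_closure hy)
    have h2 := inner_le_supportFun hb (-ξ) (subset_closure hz)
    rw [inner_add_right, inner_smul_right, hxi] at h1
    rw [inner_neg_left, inner_sub_right, inner_smul_right, hxi] at h2
    linarith
  have hc := continuous_supportFun hb ⟨x, hx⟩
  have hvol : 0 < volume.real (ball (0 : Eu n) 1) :=
    ENNReal.toReal_pos (measure_ball_pos _ _ one_pos).ne' measure_ball_lt_top.ne
  have hn0 : (0 : ℝ) < n := by exact_mod_cast (by omega : 0 < n)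
  refine mul_pos (by positivity) ?_
  have hint : Integrable (fun ξ : sphere (0 : Eu n) 1 =>
      supportFun Ω ξ + supportFun Ω (-(ξ : Eu n))) (volume : Measure (Eu n)).toSphere :=
    ((hc.comp continuous_subtype_val).add
      (hc.comp continuous_subtype_val.neg)).integrable_of_hasCompactSupport
      (HasCompactSupport.of_compactSpace _)
  have := integral_mono (integrable_const r) hint hpos
  rw [integral_const, Measure.toSphere_real_apply_univ, finrank_euclideanSpace_fin,
    smul_eq_mul] at this
  exact lt_of_lt_of_le (by positivity) this

/-- Rotations of a continuous function on the sphere, as an element of `C(S, ℝ)`. -/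
noncomputable def rotatedMap (f : C(sphere (0 : Eu n) 1, ℝ)) : C(Rot n, C(sphere (0 : Eu n) 1, ℝ)) :=
  ContinuousMap.curry ⟨fun q => f (rotSphere q.1⁻¹ q.2),
    f.continuous.comp (continuous_rotSphere continuous_fst.inv continuous_snd)⟩

lemma rotatedMap_apply (f : C(sphere (0 : Eu n) 1, ℝ)) (ρ : Rot n) (ξ : sphere (0 : Eu n) 1) :
    rotatedMap f ρ ξ = f (rotSphere ρ⁻¹ ξ) := rfl

/-- There is a sequence of rotations along which the means of the rotated copies of `f` converge
uniformly to the average of `f` over the rotation group. -/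
lemma exists_rot_seq_tendsto (f : C(sphere (0 : Eu n) 1, ℝ)) :
    ∃ ρ : ℕ → Rot n, Tendsto
      (fun m : ℕ => (m : ℝ)⁻¹ • ∑ i ∈ Finset.range m, rotatedMap f (ρ i)) atTop
      (𝓝 (∫ τ, rotatedMap f τ ∂(haarRot n))) := by
  let _ : MeasurableSpace C(sphere (0 : Eu n) 1, ℝ) := borel _
  have : BorelSpace C(sphere (0 : Eu n) 1, ℝ) := ⟨rfl⟩
  -- Under the product of Haar measures the coordinates are independent and identically distributed,
  -- so the strong law in the Banach space of continuous functions holds almost surely; any one good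
  -- sequence will do.
  set P : Measure (ℕ → Rot n) := Measure.infinitePi fun _ => haarRot n with hP
  have hmeas : Measurable (rotatedMap f) := (rotatedMap f).continuous.measurable
  have hI0 : Integrable (rotatedMap f) (haarRot n) :=
    (rotatedMap f).continuous.integrable_of_hasCompactSupport (HasCompactSupport.of_compactSpace _)
  have hmp : ∀ i, MeasurePreserving (Function.eval i) P (haarRot n) := fun i =>
    measurePreserving_eval_infinitePi (fun _ => haarRot n) i
  have hlaw := ProbabilityTheory.strong_law_ae (μ := P)
    (fun i (ω : ℕ → Rot n) => rotatedMap f (ω i)) ((hmp 0).integrable_comp_of_integrable hI0)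
    (fun i j hij => (ProbabilityTheory.iIndepFun_infinitePi (P := fun _ : ℕ => haarRot n)
      (X := fun _ => rotatedMap f) fun _ => hmeas).indepFun hij)
    (fun i => ⟨(hmeas.comp (measurable_pi_apply i)).aemeasurable,
      (hmeas.comp (measurable_pi_apply 0)).aemeasurable, by
        have h : ∀ j, Measure.map (fun ω : ℕ → Rot n => rotatedMap f (ω j)) P =
            Measure.map (rotatedMap f) (haarRot n) := fun j => by
          rw [← (hmp j).map_eq, Measure.map_map hmeas (hmp j).measurable]; rfl
        rw [h, h]⟩)
  obtain ⟨ρ, hρ⟩ := hlaw.exists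
  refine ⟨ρ, ?_⟩
  have hE : ∫ ω, rotatedMap f (ω 0) ∂P = ∫ τ, rotatedMap f τ ∂(haarRot n) := by
    rw [← (hmp 0).map_eq, integral_map (hmp 0).measurable.aemeasurable
      (rotatedMap f).continuous.aestronglyMeasurable_of_compactSpace]
  rwa [hE] at hρ

/-- Along some sequence of rotations the means of the rotated copies of `Ω` converge to the ball
with the same mean width, centred at the origin. -/
theorem exists_isSymmetrizing (hn : 2 ≤ n) {Ω : Set (Eu n)} (ho : IsOpen Ω)
    (hb : Bornology.IsBounded Ω) (hc : Convex ℝ Ω) (hne : Ω.Nonempty) :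
    ∃ ρ : ℕ → Rot n, IsSymmetrizing Ω ρ 0 := by
  set f : C(sphere (0 : Eu n) 1, ℝ) :=
    ⟨fun ξ => supportFun Ω ξ, (continuous_supportFun hb hne).comp continuous_subtype_val⟩
  obtain ⟨ρ, hρ⟩ := exists_rot_seq_tendsto f
  refine ⟨ρ, ?_⟩
  set r := meanWidth Ω / 2 with hr
  have hr0 : 0 < r := half_pos (meanWidth_pos hn ho hb hne)
  have hI0 : Integrable (rotatedMap f) (haarRot n) :=
    (rotatedMap f).continuous.integrable_of_hasCompactSupport (HasCompactSupport.of_compactSpace _)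
  have hmean : ∀ ξ : sphere (0 : Eu n) 1, (∫ τ, rotatedMap f τ ∂(haarRot n)) ξ = r := by
    intro ξ
    have := (ContinuousMap.evalCLM ℝ ξ).integral_comp_comm hI0
    rw [hr, ← integral_supportFun_rot Ω hn hb hne ξ]
    exact this.symm
  rw [IsSymmetrizing, ENNReal.tendsto_atTop_zero]
  intro ε hε
  obtain ⟨δ, hδ0, hδε⟩ : ∃ δ : ℝ, 0 < δ ∧ ENNReal.ofReal (2 * δ) ≤ ε := by
    rcases eq_or_ne ε ⊤ with rfl | hε'
    · exact ⟨1, one_pos, le_top⟩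
    · refine ⟨ε.toReal / 2, half_pos (ENNReal.toReal_pos hε.ne' hε'), ?_⟩
      rw [mul_div_cancel₀ _ two_ne_zero, ENNReal.ofReal_toReal hε']
  -- The Hausdorff bound requires an error smaller than the radius.
  set δ' := min δ (r / 2)
  have hδ' : 0 < δ' := lt_min hδ0 (half_pos hr0)
  obtain ⟨N, hN⟩ := (Metric.tendsto_atTop.1 hρ) δ' hδ'
  refine ⟨N, fun m hm => ?_⟩
  refine (hausdorffEDist_rotationMean_ball_le hb hc hne hδ'
    ((min_le_right _ _).trans_lt (half_lt_self hr0)) fun ξ hξ => ?_).trans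
      ((ENNReal.ofReal_le_ofReal (by gcongr; exact min_le_left _ _)).trans hδε)
  have h1 := (ContinuousMap.dist_apply_le_dist ⟨ξ, mem_sphere_zero_iff_norm.2 hξ⟩).trans
    (hN m hm).le
  have h2 : ((m : ℝ)⁻¹ • ∑ i ∈ Finset.range m, rotatedMap f (ρ i))
      ⟨ξ, mem_sphere_zero_iff_norm.2 hξ⟩ = meanSupport Ω ρ m ξ := by
    rw [meanSupport, one_div, Fin.sum_univ_eq_sum_range (fun i => supportFun Ω (rot (ρ i)⁻¹ ξ))]
    simp [rotatedMap_apply, f, rotSphere]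
  rwa [hmean, Real.dist_eq, h2] at h1

end

section

variable {n : ℕ}

/-! ### The Brunn–Minkowski inequality -/

/-- The translates `A + min B` and `max A + B` lie in `A + B` and meet in a single point. -/
lemma volume_add_le_volume_add_set {A B : Set ℝ} (hA : IsCompact A) (hB : IsCompact B)
    (hAn : A.Nonempty) (hBn : B.Nonempty) : volume A + volume B ≤ volume (A + B) := by
  obtain ⟨a, ha, hamax⟩ := hA.exists_isGreatest hAn
  obtain ⟨b, hb, hbmin⟩ := hB.exists_isLeast hBn
  have h1 : volume ((fun x => x + b) '' A) = volume A := by simp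
  have h2 : volume ((fun x => a + x) '' B) = volume B := by simp
  have hd : AEDisjoint volume ((fun x => x + b) '' A) ((fun x => a + x) '' B) := by
    refine measure_mono_null (t := {a + b}) ?_ (measure_singleton _)
    rintro _ ⟨⟨x, hx, rfl⟩, ⟨y, hy, hxy⟩⟩
    have := hamax hx
    have := hbmin hy
    simp only at hxy
    rw [mem_singleton_iff]
    linarith
  rw [← h1, ← h2, ← measure_union₀ (hB.image (by fun_prop)).measurableSet.nullMeasurableSet hd]
  refine measure_mono (union_subset ?_ ?_)
  · rintro _ ⟨x, hx, rfl⟩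
    exact add_mem_add hx hb
  · rintro _ ⟨x, hx, rfl⟩
    exact add_mem_add ha hx

/-- Inner regularity reduces this to compact subsets, and adjoining fixed points `a`, `b` keeps
these nonempty, as the compact case needs. -/
lemma volume_convexComb_le {A B C : Set ℝ} (hA : MeasurableSet A) (hB : MeasurableSet B)
    (hAn : A.Nonempty) (hBn : B.Nonempty) {s : ℝ} (hs0 : 0 < s) (hs1 : s < 1)
    (hC : ∀ x ∈ A, ∀ y ∈ B, (1 - s) * x + s * y ∈ C) :
    ENNReal.ofReal (1 - s) * volume A + ENNReal.ofReal s * volume B ≤ volume C := by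
  obtain ⟨a, ha⟩ := hAn
  obtain ⟨b, hb⟩ := hBn
  have sup : ∀ S : Set ℝ, MeasurableSet S →
      volume S = ⨆ K : {K : Set ℝ // K ⊆ S ∧ IsCompact K}, volume (K : Set ℝ) := by
    intro S hS
    rw [hS.measure_eq_iSup_isCompact, iSup_subtype]
    simp only [iSup_and]
  have : ∀ S : Set ℝ, Nonempty {K : Set ℝ // K ⊆ S ∧ IsCompact K} :=
    fun S => ⟨⟨∅, empty_subset _, isCompact_empty⟩⟩
  rw [sup A hA, sup B hB, ENNReal.mul_iSup, ENNReal.mul_iSup]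
  refine ENNReal.iSup_add_iSup_le ?_
  rintro ⟨K, hKA, hK⟩ ⟨L, hLB, hL⟩
  have hsm : ∀ (c : ℝ) (S : Set ℝ), 0 < c → ENNReal.ofReal c * volume S = volume (c • S) := by
    intro c S hc
    rw [Measure.addHaar_smul, Module.finrank_self, pow_one, abs_of_pos hc]
  calc ENNReal.ofReal (1 - s) * volume K + ENNReal.ofReal s * volume L
      ≤ ENNReal.ofReal (1 - s) * volume (insert a K) + ENNReal.ofReal s * volume (insert b L) := by
        gcongr <;> exact subset_insert _ _
    _ = volume ((1 - s) • insert a K) + volume (s • insert b L) := by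
        rw [hsm _ _ (by linarith), hsm _ _ hs0]
    _ ≤ volume ((1 - s) • insert a K + s • insert b L) :=
        volume_add_le_volume_add_set ((hK.insert a).smul _) ((hL.insert b).smul _)
          ((insert_nonempty _ _).smul_set) ((insert_nonempty _ _).smul_set)
    _ ≤ volume C := by
        refine measure_mono ?_
        rintro _ ⟨_, ⟨x, hx, rfl⟩, _, ⟨y, hy, rfl⟩, rfl⟩
        exact hC x (insert_subset ha hKA hx) y (insert_subset hb hLB hy)

/-- The one-dimensional Prékopa–Leindler inequality for functions with supremum `1`. -/
lemma lintegral_convexComb_le {f g h : ℝ → ℝ} (hf : Measurable f) (hg : Measurable g)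
    (hh : Measurable h) (hf0 : ∀ x, 0 ≤ f x) (hg0 : ∀ x, 0 ≤ g x) (hh0 : ∀ x, 0 ≤ h x)
    (hf1 : ∀ x, f x ≤ 1) (hg1 : ∀ x, g x ≤ 1) (hfs : ∀ t < 1, ∃ x, t < f x)
    (hgs : ∀ t < 1, ∃ x, t < g x) {s : ℝ} (hs0 : 0 < s) (hs1 : s < 1)
    (hfgh : ∀ x y t, t < f x → t < g y → t < h ((1 - s) * x + s * y)) :
    ENNReal.ofReal (1 - s) * (∫⁻ x, ENNReal.ofReal (f x)) +
      ENNReal.ofReal s * (∫⁻ x, ENNReal.ofReal (g x)) ≤ ∫⁻ x, ENNReal.ofReal (h x) := by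
  rw [lintegral_eq_lintegral_meas_lt volume (ae_of_all _ hf0) hf.aemeasurable,
    lintegral_eq_lintegral_meas_lt volume (ae_of_all _ hg0) hg.aemeasurable,
    lintegral_eq_lintegral_meas_lt volume (ae_of_all _ hh0) hh.aemeasurable]
  have anti : ∀ k : ℝ → ℝ, Measurable fun t : ℝ => volume {x | t < k x} := by
    intro k
    refine Antitone.measurable fun t t' htt' => measure_mono fun x hx => lt_of_le_of_lt htt' hx
  rw [← lintegral_const_mul _ (anti f), ← lintegral_const_mul _ (anti g),
    ← lintegral_add_left ((anti f).const_mul _)]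
  -- After the layer cake formula the inequality holds level by level. Below `1` both superlevel
  -- sets are nonempty, since the suprema are `1`; from `1` on they are empty.
  refine lintegral_mono fun t => ?_
  rcases lt_or_ge t 1 with ht | ht
  · exact volume_convexComb_le (measurableSet_lt measurable_const hf)
      (measurableSet_lt measurable_const hg) (hfs t ht) (hgs t ht) hs0 hs1
      fun x hx y hy => hfgh x y t hx hy
  · have h1 : {x | t < f x} = ∅ := eq_empty_of_forall_notMem fun x hx =>
      absurd (hf1 x) (not_le.2 (ht.trans_lt hx))
    have h2 : {x | t < g x} = ∅ := eq_empty_of_forall_notMem fun x hx =>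
      absurd (hg1 x) (not_le.2 (ht.trans_lt hx))
    simp [h1, h2]

lemma ennreal_geom_mean_le_arith_mean {a b : ℝ≥0∞} {s : ℝ} (hs0 : 0 < s) (hs1 : s < 1) :
    a ^ (1 - s) * b ^ s ≤ ENNReal.ofReal (1 - s) * a + ENNReal.ofReal s * b := by
  have h1 : ENNReal.ofReal (1 - s) ≠ 0 := by simpa using hs1
  have h2 : ENNReal.ofReal s ≠ 0 := by simpa using hs0
  rcases eq_or_ne a ⊤ with rfl | ha
  · rw [ENNReal.mul_top h1, top_add]; exact le_top
  rcases eq_or_ne b ⊤ with rfl | hb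
  · rw [ENNReal.mul_top h2, add_top]; exact le_top
  lift a to NNReal using ha
  lift b to NNReal using hb
  have := NNReal.geom_mean_le_arith_mean2_weighted (1 - s).toNNReal s.toNNReal a b (by
    rw [← Real.toNNReal_add (by linarith) hs0.le]; simp)
  rw [Real.coe_toNNReal _ (by linarith), Real.coe_toNNReal _ hs0.le] at this
  rw [← ENNReal.coe_rpow_of_nonneg _ (by linarith), ← ENNReal.coe_rpow_of_nonneg _ hs0.le]
  simp only [ENNReal.ofReal]
  exact_mod_cast this

/-- The one-dimensional Prékopa–Leindler inequality for bounded functions. -/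
lemma prekopa_leindler_real {f g h : ℝ → ℝ} (hf : Measurable f) (hg : Measurable g)
    (hh : Measurable h) (hf0 : ∀ x, 0 ≤ f x) (hg0 : ∀ x, 0 ≤ g x) (hh0 : ∀ x, 0 ≤ h x)
    (hfb : BddAbove (range f)) (hgb : BddAbove (range g)) {s : ℝ} (hs0 : 0 < s) (hs1 : s < 1)
    (hfgh : ∀ x y, f x ^ (1 - s) * g y ^ s ≤ h ((1 - s) * x + s * y)) :
    (∫⁻ x, ENNReal.ofReal (f x)) ^ (1 - s) * (∫⁻ x, ENNReal.ofReal (g x)) ^ s ≤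
      ∫⁻ x, ENNReal.ofReal (h x) := by
  have hs1' : 0 < 1 - s := by linarith
  have norm_case : ∀ k : ℝ → ℝ, (∀ x, 0 ≤ k x) → BddAbove (range k) →
      (∫⁻ x, ENNReal.ofReal (k x)) = 0 ∨ 0 < ⨆ x, k x := by
    intro k hk0 hkb
    rcases (Real.iSup_nonneg hk0).eq_or_lt with h0 | h0
    · left
      have : ∀ x, k x = 0 := fun x => le_antisymm (h0.symm ▸ le_ciSup hkb x) (hk0 x)
      simp [this]
    · exact Or.inr h0
  rcases norm_case f hf0 hfb with h0 | ha
  · rw [h0, ENNReal.zero_rpow_of_pos hs1', zero_mul]; exact zero_le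
  rcases norm_case g hg0 hgb with h0 | hb
  · rw [h0, ENNReal.zero_rpow_of_pos hs0, mul_zero]; exact zero_le
  set a := ⨆ x, f x
  set b := ⨆ x, g x
  -- Dividing `f`, `g`, `h` by `a`, `b`, `c` preserves the multiplicative hypothesis and normalizes
  -- the suprema of `f` and `g`. The additive inequality for the quotients then implies the
  -- multiplicative one by the arithmetic–geometric mean inequality.
  set c := a ^ (1 - s) * b ^ s with hc
  have hc0 : 0 < c := by positivity
  have hscale : ∀ (k : ℝ → ℝ) (d : ℝ), 0 < d → Measurable k →
      ∫⁻ x, ENNReal.ofReal (k x) = ENNReal.ofReal d * ∫⁻ x, ENNReal.ofReal (k x / d) := by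
    intro k d hd hk
    rw [← lintegral_const_mul _ (hk.div_const d).ennreal_ofReal]
    refine lintegral_congr fun x => ?_
    rw [← ENNReal.ofReal_mul hd.le, mul_div_cancel₀ _ hd.ne']
  have key := lintegral_convexComb_le (f := fun x => f x / a) (g := fun x => g x / b)
    (h := fun x => h x / c) (hf.div_const a) (hg.div_const b) (hh.div_const c)
    (fun x => div_nonneg (hf0 x) ha.le) (fun x => div_nonneg (hg0 x) hb.le)
    (fun x => div_nonneg (hh0 x) hc0.le) (fun x => (div_le_one ha).2 (le_ciSup hfb x))
    (fun x => (div_le_one hb).2 (le_ciSup hgb x))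
    (fun t ht => by
      obtain ⟨x, hx⟩ := exists_lt_of_lt_ciSup (show t * a < ⨆ x, f x by
        exact mul_lt_of_lt_one_left ha ht)
      exact ⟨x, (lt_div_iff₀ ha).2 hx⟩)
    (fun t ht => by
      obtain ⟨x, hx⟩ := exists_lt_of_lt_ciSup (show t * b < ⨆ x, g x by
        exact mul_lt_of_lt_one_left hb ht)
      exact ⟨x, (lt_div_iff₀ hb).2 hx⟩)
    hs0 hs1 (fun x y t htf htg => by
      rcases lt_or_ge t 0 with ht | ht
      · exact ht.trans_le (div_nonneg (hh0 _) hc0.le)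
      · have h1 : t ^ (1 - s) < (f x / a) ^ (1 - s) := Real.rpow_lt_rpow ht htf hs1'
        have h2 : t ^ s < (g y / b) ^ s := Real.rpow_lt_rpow ht htg hs0
        have h3 : t = t ^ (1 - s) * t ^ s := by
          rw [← Real.rpow_add_of_nonneg ht hs1'.le hs0.le]; simp
        rw [h3]
        calc t ^ (1 - s) * t ^ s < (f x / a) ^ (1 - s) * (g y / b) ^ s :=
              mul_lt_mul'' h1 h2 (by positivity) (by positivity)
          _ = f x ^ (1 - s) * g y ^ s / c := by
              rw [Real.div_rpow (hf0 x) ha.le, Real.div_rpow (hg0 y) hb.le, hc]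
              field_simp
          _ ≤ h ((1 - s) * x + s * y) / c := by
              gcongr
              exact hfgh x y)
  rw [hscale f a ha hf, hscale g b hb hg, hscale h c hc0 hh,
    ENNReal.mul_rpow_of_nonneg _ _ hs1'.le, ENNReal.mul_rpow_of_nonneg _ _ hs0.le,
    ENNReal.ofReal_rpow_of_pos ha, ENNReal.ofReal_rpow_of_pos hb, mul_mul_mul_comm,
    ← ENNReal.ofReal_mul (by positivity), ← hc]
  gcongr
  exact (ennreal_geom_mean_le_arith_mean hs0 hs1).trans key

/-- Induction on the dimension: slicing by the first coordinate, the induction hypothesis says that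
the slice volumes satisfy the hypothesis of the one-dimensional Prékopa–Leindler inequality. In
dimension `0` every nonempty set has volume `1`. -/
lemma brunn_minkowski_pi {s : ℝ} (hs0 : 0 < s) (hs1 : s < 1) (d : ℕ) :
    ∀ A B C : Set (Fin d → ℝ), IsCompact A → IsCompact B → IsCompact C →
      (∀ x ∈ A, ∀ y ∈ B, (1 - s) • x + s • y ∈ C) →
      volume A ^ (1 - s) * volume B ^ s ≤ volume C := by
  have hs1' : 0 < 1 - s := by linarith
  induction d with
  | zero =>
    intro A B C _ _ _ hC
    rcases A.eq_empty_or_nonempty with rfl | ⟨x, hx⟩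
    · rw [measure_empty, ENNReal.zero_rpow_of_pos hs1', zero_mul]; exact zero_le
    rcases B.eq_empty_or_nonempty with rfl | ⟨y, hy⟩
    · rw [measure_empty, ENNReal.zero_rpow_of_pos hs0, mul_zero]; exact zero_le
    have hu : ∀ S : Set (Fin 0 → ℝ), S.Nonempty → volume S = 1 := by
      intro S hS
      rw [Subsingleton.eq_univ_of_nonempty hS]
      simp [volume_pi]
    rw [hu A ⟨x, hx⟩, hu B ⟨y, hy⟩, hu C ⟨_, hC x hx y hy⟩]
    simp
  | succ d ih =>
    intro A B C hA hB hC hABC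
    set E : ℝ × (Fin d → ℝ) → (Fin (d + 1) → ℝ) := fun q => Fin.cons q.1 q.2 with hE
    have hEc : Continuous E := by
      refine continuous_pi fun i => ?_
      refine Fin.cases ?_ (fun j => ?_) i
      · simpa [hE] using continuous_fst
      · simp only [hE, Fin.cons_succ]
        exact (continuous_apply j).comp continuous_snd
    have hEmp : MeasurePreserving E := by
      have := (volume_preserving_piFinSuccAbove (fun _ : Fin (d + 1) => ℝ) 0).symm
      convert this using 1
      ext q i
      simp [hE, MeasurableEquiv.piFinSuccAbove]
    have hvol : ∀ S : Set (Fin (d + 1) → ℝ), IsCompact S →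
        volume S = ∫⁻ t, volume (Prod.mk t ⁻¹' (E ⁻¹' S)) := by
      intro S hS
      rw [← hEmp.measure_preimage hS.measurableSet.nullMeasurableSet]
      exact Measure.prod_apply (hEc.measurable hS.measurableSet)
    have htail : Continuous fun x : Fin (d + 1) → ℝ => Fin.tail x :=
      continuous_pi fun i => continuous_apply i.succ
    -- All slices lie in one compact projection, which makes the slice volumes finite and uniformly
    -- bounded.
    have hsub : ∀ (S : Set (Fin (d + 1) → ℝ)) (t : ℝ),
        Prod.mk t ⁻¹' (E ⁻¹' S) ⊆ (fun x => Fin.tail x) '' S := by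
      intro S t y hy
      exact ⟨_, hy, by simp [hE]⟩
    have hcomp : ∀ (S : Set (Fin (d + 1) → ℝ)), IsCompact S → ∀ t : ℝ,
        IsCompact (Prod.mk t ⁻¹' (E ⁻¹' S)) := by
      intro S hS t
      exact (hS.image htail).of_isClosed_subset
        ((hS.isClosed.preimage hEc).preimage (Continuous.prodMk_right t)) (hsub S t)
    have hmeas : ∀ S : Set (Fin (d + 1) → ℝ), IsCompact S →
        Measurable fun t => (volume (Prod.mk t ⁻¹' (E ⁻¹' S))).toReal := fun S hS =>
      (measurable_measure_prodMk_left (hEc.measurable hS.measurableSet)).ennreal_toReal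
    have hbdd : ∀ S : Set (Fin (d + 1) → ℝ), IsCompact S →
        BddAbove (range fun t => (volume (Prod.mk t ⁻¹' (E ⁻¹' S))).toReal) := by
      intro S hS
      refine ⟨(volume ((fun x => Fin.tail x) '' S)).toReal, ?_⟩
      rintro _ ⟨t, rfl⟩
      exact ENNReal.toReal_mono (hS.image htail).measure_lt_top.ne (measure_mono (hsub S t))
    have hvol' : ∀ S : Set (Fin (d + 1) → ℝ), IsCompact S →
        volume S = ∫⁻ t, ENNReal.ofReal (volume (Prod.mk t ⁻¹' (E ⁻¹' S))).toReal := by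
      intro S hS
      rw [hvol S hS]
      exact lintegral_congr fun t =>
        (ENNReal.ofReal_toReal (hcomp S hS t).measure_lt_top.ne).symm
    rw [hvol' A hA, hvol' B hB, hvol' C hC]
    refine prekopa_leindler_real (hmeas A hA) (hmeas B hB) (hmeas C hC)
      (fun _ => ENNReal.toReal_nonneg) (fun _ => ENNReal.toReal_nonneg)
      (fun _ => ENNReal.toReal_nonneg) (hbdd A hA) (hbdd B hB) hs0 hs1 fun x y => ?_
    rw [ENNReal.toReal_rpow, ENNReal.toReal_rpow, ← ENNReal.toReal_mul]
    refine ENNReal.toReal_mono (hcomp C hC _).measure_lt_top.ne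
      (ih _ _ _ (hcomp A hA x) (hcomp B hB y) (hcomp C hC _) fun z hz w hw => ?_)
    have := hABC _ hz _ hw
    simp only [mem_preimage, hE]
    convert this using 1
    ext i
    refine Fin.cases ?_ (fun j => ?_) i <;> simp [hE]

/-- The multiplicative Brunn–Minkowski inequality for compact sets. -/
lemma brunn_minkowski {s : ℝ} (hs0 : 0 < s) (hs1 : s < 1) {A B : Set (Eu n)}
    (hA : IsCompact A) (hB : IsCompact B) :
    volume A ^ (1 - s) * volume B ^ s ≤ volume ((1 - s) • A + s • B) := by
  have hmp := PiLp.volume_preserving_toLp (Fin n)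
  have hv : ∀ S : Set (Eu n), IsCompact S → volume S = volume (WithLp.toLp 2 ⁻¹' S) := fun S hS =>
    (hmp.measure_preimage hS.measurableSet.nullMeasurableSet).symm
  have hc : ∀ S : Set (Eu n), IsCompact S →
      IsCompact (WithLp.toLp 2 ⁻¹' S : Set (Fin n → ℝ)) := fun S hS =>
    (PiLp.homeomorph 2 (fun _ : Fin n => ℝ)).symm.isCompact_preimage.2 hS
  have hAB : IsCompact ((1 - s) • A + s • B) := (hA.smul _).add (hB.smul _)
  rw [hv A hA, hv B hB, hv _ hAB]
  refine brunn_minkowski_pi hs0 hs1 n _ _ _ (hc A hA) (hc B hB) (hc _ hAB) fun x hx y hy => ?_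
  exact add_mem_add (smul_mem_smul_set hx) (smul_mem_smul_set hy)

/-- Rotation means do not decrease the volume of compact sets. -/
lemma volume_le_volume_image_meanMap {K : Set (Eu n)} (hK : IsCompact K) (ρ : ℕ → Rot n) (m : ℕ) :
    volume K ≤ volume (meanMap ρ (m + 1) '' univ.pi fun _ => K) := by
  induction m with
  | zero =>
    rw [← volume_rot_image (ρ 0) K]
    refine measure_mono ?_
    rintro _ ⟨y, hy, rfl⟩
    exact ⟨fun _ => y, fun _ _ => hy, by simp [meanMap_apply]⟩
  | succ m ih =>
    -- The mean of `m + 2` copies is `1 - s` times the mean of the first `m + 1` plus `s` times the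
    -- last.
    set s : ℝ := 1 / (m + 2 : ℝ) with hs
    have hm2 : (0 : ℝ) < m + 2 := by positivity
    have hs0 : 0 < s := by positivity
    have hs1 : s < 1 := by rw [hs, div_lt_one hm2]; linarith [(Nat.cast_nonneg m : (0 : ℝ) ≤ m)]
    have hcomp : IsCompact (meanMap ρ (m + 1) '' univ.pi fun _ => K) :=
      (isCompact_univ_pi fun _ => hK).image (meanMap ρ (m + 1)).continuous
    calc volume K = volume K ^ (1 - s) * volume K ^ s := by
          rw [← ENNReal.rpow_add_of_nonneg _ _ (by linarith) hs0.le]; simp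
      _ ≤ volume (meanMap ρ (m + 1) '' univ.pi fun _ => K) ^ (1 - s) *
            volume (rot (ρ (m + 1)) '' K) ^ s := by
          rw [volume_rot_image]
          gcongr
      _ ≤ volume ((1 - s) • (meanMap ρ (m + 1) '' univ.pi fun _ => K) +
            s • (rot (ρ (m + 1)) '' K)) :=
          brunn_minkowski hs0 hs1 hcomp (hK.image (continuous_rot _))
      _ ≤ _ := by
          refine measure_mono ?_
          rintro _ ⟨_, ⟨_, ⟨y, hy, rfl⟩, rfl⟩, _, ⟨_, ⟨z, hz, rfl⟩, rfl⟩, rfl⟩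
          refine ⟨Fin.snoc (α := fun _ => Eu n) y z, fun i _ => ?_, ?_⟩
          · refine Fin.lastCases ?_ (fun j => ?_) i
            · simpa using hz
            · simpa using hy j (mem_univ j)
          · simp only [meanMap_apply, Fin.sum_univ_castSucc (n := m + 1), Fin.snoc_castSucc,
              Fin.snoc_last, Fin.val_castSucc, Fin.val_last, smul_add, smul_smul]
            have h1 : (1 : ℝ) / ((m + 1 + 1 : ℕ) : ℝ) = s := by
              rw [hs]; push_cast; congr 1; ring
            have h2 : (1 - s) * (1 / ((m + 1 : ℕ) : ℝ)) = s := by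
              rw [hs]; push_cast; field_simp; ring
            rw [h1, h2]

end

section

variable {n : ℕ} {Ω : Set (Eu n)} {u : Eu n → ℝ} {p : ℝ} {ρ : ℕ → Rot n} {m : ℕ}

/-! ### Rotation means of functions -/

/-- The mean `m⁻¹ ∑ u(yᵢ)^p`. -/
noncomputable def avgPow (p : ℝ) (u : Eu n → ℝ) {m : ℕ} (y : Fin m → Eu n) : ℝ :=
  (1 / (m : ℝ)) * ∑ i, u (y i) ^ p

lemma avgPow_nonneg (hu0 : ∀ x ∈ closure Ω, 0 ≤ u x) {y : Fin m → Eu n}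
    (hy : ∀ i, y i ∈ closure Ω) : 0 ≤ avgPow p u y :=
  mul_nonneg (by positivity) (Finset.sum_nonneg fun i _ => Real.rpow_nonneg (hu0 _ (hy i)) _)

/-- For `m = 0` the mean is `0`, which is why `a` must be nonnegative. -/
lemma one_div_mul_sum_le_add {f d : Fin m → ℝ} {a C b : ℝ} (ha : 0 ≤ a) (hC : 0 ≤ C)
    (hf : ∀ i, f i ≤ a + C * d i) (hd : (1 / (m : ℝ)) * ∑ i, d i ≤ b) :
    (1 / (m : ℝ)) * ∑ i, f i ≤ a + C * b := by
  have h1 : ∑ i, f i ≤ m * a + C * ∑ i, d i := by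
    refine (Finset.sum_le_sum fun i _ => hf i).trans_eq ?_
    rw [Finset.sum_add_distrib, ← Finset.mul_sum]
    simp
  have h2 : (1 / (m : ℝ)) * (m * a) ≤ a := by
    rcases Nat.eq_zero_or_pos m with rfl | hm
    · simpa using ha
    · have : (m : ℝ) ≠ 0 := by positivity
      rw [← mul_assoc, one_div_mul_cancel this, one_mul]
  calc (1 / (m : ℝ)) * ∑ i, f i ≤ (1 / (m : ℝ)) * (m * a + C * ∑ i, d i) := by gcongr
    _ = (1 / (m : ℝ)) * (m * a) + C * ((1 / (m : ℝ)) * ∑ i, d i) := by ring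
    _ ≤ a + C * b := by gcongr

/-- Substituting `ρᵢ yᵢ` for the `i`-th point turns the supremum into one over a fiber of the linear
map `meanMap` in a power of `closure Ω`. -/
lemma rotationMeanFun_eq (p : ℝ) (Ω : Set (Eu n)) (u : Eu n → ℝ) (ρ : ℕ → Rot n) (m : ℕ)
    (x : Eu n) : rotationMeanFun p Ω u ρ m x =
      sSup ((fun y : Fin m → Eu n => avgPow p u y ^ (1 / p)) ''
        ((univ.pi fun _ => closure Ω) ∩ meanMap ρ m ⁻¹' {x})) := by
  rw [rotationMeanFun, pConvolution]
  congr 1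
  ext s
  simp only [closure_rot_image, rotateFun, pMean, mem_image, mem_inter_iff, mem_univ_pi,
    mem_preimage, mem_singleton_iff]
  constructor
  · rintro ⟨z, hz, rfl, rfl⟩
    choose y hy hyz using hz
    refine ⟨y, ⟨hy, ?_⟩, ?_⟩
    · rw [meanMap_apply, Finset.smul_sum]
      simp_rw [hyz]
    · rw [avgPow, Finset.mul_sum]
      congr 1
      refine Finset.sum_congr rfl fun i _ => ?_
      rw [← hyz, rot_inv_rot]
  · rintro ⟨y, ⟨hy, rfl⟩, rfl⟩
    refine ⟨fun i => rot (ρ i) (y i), fun i => ⟨y i, hy i, rfl⟩, ?_, ?_⟩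
    · rw [meanMap_apply, Finset.smul_sum]
    · rw [avgPow, Finset.mul_sum]
      simp only [rot_inv_rot]

lemma continuousOn_avgPow (hp : 0 < p) (hcu : ContinuousOn u (closure Ω)) :
    ContinuousOn (fun y : Fin m → Eu n => avgPow p u y) (univ.pi fun _ => closure Ω) := by
  refine continuousOn_const.mul (continuousOn_finsetSum _ fun i _ => ?_)
  refine ContinuousOn.rpow_const ?_ fun _ _ => Or.inr hp.le
  exact hcu.comp (continuous_apply i).continuousOn fun y hy => hy i (mem_univ i)

lemma isCompact_fiber (hb : Bornology.IsBounded Ω) (x : Eu n) :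
    IsCompact ((univ.pi fun _ => closure Ω) ∩ meanMap ρ m ⁻¹' {x}) :=
  (isCompact_univ_pi fun _ => isCompact_closure_of_isBounded hb).inter_right
    (isClosed_singleton.preimage (meanMap ρ m).continuous)

lemma rotationMeanFun_of_notMem {x : Eu n} (hx : x ∉ closedMean Ω ρ m) :
    rotationMeanFun p Ω u ρ m x = 0 := by
  rw [rotationMeanFun_eq]
  have : (univ.pi fun _ => closure Ω) ∩ meanMap ρ m ⁻¹' {x} = ∅ :=
    eq_empty_of_forall_notMem fun y hy => hx ⟨y, hy.1, hy.2⟩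
  rw [this, image_empty, Real.sSup_empty]

lemma rotationMeanFun_nonneg (hu0 : ∀ x ∈ closure Ω, 0 ≤ u x) (x : Eu n) :
    0 ≤ rotationMeanFun p Ω u ρ m x := by
  rw [rotationMeanFun_eq]
  refine Real.sSup_nonneg ?_
  rintro _ ⟨y, hy, rfl⟩
  exact Real.rpow_nonneg (avgPow_nonneg hu0 fun i => hy.1 i (mem_univ i)) _

lemma avgPow_le_rotationMeanFun (hp : 0 < p) (hb : Bornology.IsBounded Ω)
    (hcu : ContinuousOn u (closure Ω)) (hu0 : ∀ x ∈ closure Ω, 0 ≤ u x) {y : Fin m → Eu n}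
    (hy : ∀ i, y i ∈ closure Ω) :
    avgPow p u y ≤ rotationMeanFun p Ω u ρ m (meanMap ρ m y) ^ p := by
  have h1 : avgPow p u y ^ (1 / p) ≤ rotationMeanFun p Ω u ρ m (meanMap ρ m y) := by
    rw [rotationMeanFun_eq]
    refine le_csSup ((isCompact_fiber hb _).bddAbove_image ?_)
      (mem_image_of_mem _ ⟨fun i _ => hy i, rfl⟩)
    exact ((continuousOn_avgPow hp hcu).mono inter_subset_left).rpow_const
      fun _ _ => Or.inr (by positivity)
  have h2 := Real.rpow_le_rpow (Real.rpow_nonneg (avgPow_nonneg hu0 hy) _) h1 hp.le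
  rwa [one_div, Real.rpow_inv_rpow (avgPow_nonneg hu0 hy) hp.ne'] at h2

/-- The supremum that defines the rotation mean is attained. -/
lemma exists_rotationMeanFun_eq (hp : 0 < p) (hb : Bornology.IsBounded Ω)
    (hcu : ContinuousOn u (closure Ω)) (hu0 : ∀ x ∈ closure Ω, 0 ≤ u x) {x : Eu n}
    (hx : x ∈ closedMean Ω ρ m) :
    ∃ y : Fin m → Eu n, (∀ i, y i ∈ closure Ω) ∧ meanMap ρ m y = x ∧
      rotationMeanFun p Ω u ρ m x ^ p = avgPow p u y := by
  obtain ⟨y₀, hy₀, hy₀x⟩ := hx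
  obtain ⟨y, hy, h, -⟩ := (isCompact_fiber (ρ := ρ) (m := m) hb x).exists_sSup_image_eq_and_ge
    ⟨y₀, hy₀, hy₀x⟩ (f := fun y : Fin m → Eu n => avgPow p u y ^ (1 / p))
    (((continuousOn_avgPow hp hcu).mono inter_subset_left).rpow_const
      fun _ _ => Or.inr (by positivity))
  have hyc : ∀ i, y i ∈ closure Ω := fun i => hy.1 i (mem_univ i)
  refine ⟨y, hyc, hy.2, ?_⟩
  rw [rotationMeanFun_eq, h, one_div, Real.rpow_inv_rpow (avgPow_nonneg hu0 hyc) hp.ne']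

/-! ### Equicontinuity -/

/-- Uniform continuity and the zero boundary values handle points close to `z`; at distance at least
`δ` the slope `max M 0 / δ` already exceeds the bound on `u ^ p`. An affine modulus is wanted
because it can be averaged when only the mean of the distances is under control. -/
lemma exists_rpow_le_add_mul_dist (hp : 0 < p) (ho : IsOpen Ω) (hb : Bornology.IsBounded Ω)
    (hcu : ContinuousOn u (closure Ω))
    (hbd : ∀ x ∈ frontier Ω, u x = 0) {ε : ℝ} (hε : 0 < ε) :
    ∃ C : ℝ, 0 ≤ C ∧ ∀ y ∈ closure Ω, ∀ z ∉ Ω, u y ^ p ≤ ε + C * dist y z := by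
  have hK := isCompact_closure_of_isBounded hb
  have hcw : ContinuousOn (fun y => u y ^ p) (closure Ω) :=
    hcu.rpow_const fun _ _ => Or.inr hp.le
  obtain ⟨δ, hδ, hunif⟩ :=
    Metric.uniformContinuousOn_iff.1 (hK.uniformContinuousOn_of_continuous hcw) ε hε
  obtain ⟨M, hM⟩ := hK.exists_bound_of_continuousOn hcw
  have hM' : ∀ y ∈ closure Ω, u y ^ p ≤ max M 0 := fun y hy =>
    (le_abs_self _).trans ((hM y hy).trans (le_max_left _ _))
  refine ⟨max M 0 / δ, by positivity, fun y hy z hz => ?_⟩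
  rcases lt_or_ge (dist y z) δ with hd | hd
  -- A nearest boundary point of `y` is no farther than the exterior point `z`.
  · obtain ⟨z', hz', hdz⟩ : ∃ z' ∈ frontier Ω, dist y z' ≤ dist y z := by
      by_cases hyΩ : y ∈ Ω
      · obtain ⟨z', hz', h⟩ := exists_mem_frontier_infDist_compl_eq_dist hyΩ
          (fun h : Ω = univ => hz (h ▸ mem_univ z))
        exact ⟨z', hz', h ▸ infDist_le_dist_of_mem hz⟩
      · exact ⟨y, ⟨hy, by rwa [ho.interior_eq]⟩, by simp⟩
    have h1 := hunif y hy z' (frontier_subset_closure hz') (hdz.trans_lt hd)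
    rw [hbd z' hz', Real.zero_rpow hp.ne', Real.dist_eq, sub_zero] at h1
    have h2 : 0 ≤ max M 0 / δ * dist y z := by positivity
    linarith [le_abs_self (u y ^ p)]
  · have h1 : max M 0 ≤ max M 0 / δ * dist y z := by
      rw [div_mul_eq_mul_div, le_div_iff₀ hδ]
      exact mul_le_mul_of_nonneg_left hd (le_max_right _ _)
    linarith [hM' y hy]

/-- A point where the rotation mean exceeds `ε` has a uniform distance from the boundary. -/
lemma exists_closedBall_subset_closedMean (hp : 0 < p) (ho : IsOpen Ω)
    (hb : Bornology.IsBounded Ω) (hc : Convex ℝ Ω) (hne : Ω.Nonempty)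
    (hcu : ContinuousOn u (closure Ω)) (hu0 : ∀ x ∈ closure Ω, 0 ≤ u x)
    (hbd : ∀ x ∈ frontier Ω, u x = 0) {ε : ℝ} (hε : 0 < ε) :
    ∃ η : ℝ, 0 < η ∧ ∀ (ρ : ℕ → Rot n) (m : ℕ) (x : Eu n),
      ε < rotationMeanFun p Ω u ρ m x ^ p → closedBall x η ⊆ closedMean Ω ρ m := by
  obtain ⟨C, hC, hmod⟩ := exists_rpow_le_add_mul_dist hp ho hb hcu hbd (half_pos hε)
  -- Chosen so that `ε / 2 + C η ≤ ε`; the `+ 1` covers `C = 0`.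
  refine ⟨ε / 2 / (C + 1), by positivity, fun ρ m x hx x' hx' => ?_⟩
  set η := ε / 2 / (C + 1) with hη
  have hη0 : 0 < η := by positivity
  by_contra hx'K
  have hxK : x ∈ closedMean Ω ρ m := by
    by_contra h
    rw [rotationMeanFun_of_notMem h, Real.zero_rpow hp.ne'] at hx
    linarith
  obtain ⟨ξ, hξ, hsep⟩ : ∃ ξ : Eu n, ‖ξ‖ = 1 ∧ ∀ z ∈ closedMean Ω ρ m,
      inner ℝ ξ z < inner ℝ ξ x' := by
    by_contra! h
    exact hx'K (mem_of_forall_exists_inner_le (convex_closedMean hc)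
      (isCompact_closedMean hb).isClosed ⟨x, hxK⟩ h)
  obtain ⟨z, hz, hzs⟩ := exists_inner_eq_meanSupport (ρ := ρ) (m := m) hb hne ξ
  obtain ⟨y, hy, rfl, hyv⟩ := exists_rotationMeanFun_eq hp hb hcu hu0 hxK
  -- The distance from `yᵢ` to the supporting hyperplane of `Ω` with normal `ρᵢ⁻¹ ξ`. The mean of
  -- these gaps is the gap of `x` in the direction `ξ`, which is at most `η` because `ξ` separates
  -- `x'` from the mean.
  set d : Fin m → ℝ := fun i => supportFun Ω (rot (ρ i)⁻¹ ξ) - inner ℝ (rot (ρ i)⁻¹ ξ) (y i)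
  have hd0 : ∀ i, 0 ≤ d i := fun i => sub_nonneg.2 (inner_le_supportFun hb _ (hy i))
  have hdsum : (1 / (m : ℝ)) * ∑ i, d i ≤ η := by
    have h1 : (1 / (m : ℝ)) * ∑ i, d i =
        meanSupport Ω ρ m ξ - inner ℝ ξ (meanMap ρ m y) := by
      rw [inner_meanMap, meanSupport, ← mul_sub, ← Finset.sum_sub_distrib]
    have h2 : inner ℝ ξ x' = inner ℝ ξ (meanMap ρ m y) + inner ℝ ξ (x' - meanMap ρ m y) := by
      rw [inner_sub_right]; ring
    have h3 := real_inner_le_norm ξ (x' - meanMap ρ m y)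
    rw [hξ, one_mul, ← dist_eq_norm] at h3
    rw [mem_closedBall] at hx'
    have h4 := hsep z hz
    rw [h1]
    linarith
  have hmod' : ∀ i, u (y i) ^ p ≤ ε / 2 + C * d i := by
    intro i
    have hn1 : ‖rot (ρ i)⁻¹ ξ‖ = 1 := by rw [norm_rot, hξ]
    have hxi : inner ℝ (rot (ρ i)⁻¹ ξ) (rot (ρ i)⁻¹ ξ) = (1 : ℝ) := by
      rw [real_inner_self_eq_norm_sq, hn1, one_pow]
    -- Pushed by `dᵢ`, the point reaches the supporting hyperplane, which an open set does not meet.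
    have hout : y i + d i • rot (ρ i)⁻¹ ξ ∉ Ω := by
      intro hmem
      obtain ⟨r, hr, hball⟩ := Metric.isOpen_iff.1 ho _ hmem
      have hmem' : y i + d i • rot (ρ i)⁻¹ ξ + (r / 2) • rot (ρ i)⁻¹ ξ ∈ Ω := hball (by
        rw [mem_ball, dist_self_add_left, norm_smul, hn1, mul_one,
          Real.norm_of_nonneg (by linarith)]
        linarith)
      have := inner_le_supportFun hb (rot (ρ i)⁻¹ ξ) (subset_closure hmem')
      rw [inner_add_right, inner_add_right, inner_smul_right, inner_smul_right, hxi] at this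
      simp only [d] at this
      linarith
    have h1 := hmod (y i) (hy i) _ hout
    rwa [dist_self_add_right, norm_smul, hn1, mul_one, Real.norm_of_nonneg (hd0 i)] at h1
  have hfin := one_div_mul_sum_le_add (half_pos hε).le hC hmod' hdsum
  have h5 : C * η ≤ ε / 2 := by
    rw [hη, mul_div_assoc', div_le_iff₀ (by positivity)]
    nlinarith
  rw [hyv, avgPow] at hx
  linarith

/-- If the value at `x` exceeds `ε`, a ball of uniform radius about `x` lies in the closed mean. A
maximizer for `x`, moved by a small fraction `s` towards a tuple representing a point beyond `x'`,
becomes a competitor for `x'` whose components have hardly moved. All constants are independent of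
`ρ` and `m`. -/
lemma exists_rpow_rotationMeanFun_le_add (hp : 0 < p) (ho : IsOpen Ω)
    (hb : Bornology.IsBounded Ω) (hc : Convex ℝ Ω) (hne : Ω.Nonempty)
    (hcu : ContinuousOn u (closure Ω)) (hu0 : ∀ x ∈ closure Ω, 0 ≤ u x)
    (hbd : ∀ x ∈ frontier Ω, u x = 0) {ε : ℝ} (hε : 0 < ε) :
    ∃ δ : ℝ, 0 < δ ∧ ∀ (ρ : ℕ → Rot n) (m : ℕ) (x x' : Eu n), dist x x' ≤ δ →
      rotationMeanFun p Ω u ρ m x ^ p ≤ rotationMeanFun p Ω u ρ m x' ^ p + ε := by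
  obtain ⟨η, hη, hball⟩ := exists_closedBall_subset_closedMean hp ho hb hc hne hcu hu0 hbd hε
  have hK := isCompact_closure_of_isBounded hb
  have hcw : ContinuousOn (fun y => u y ^ p) (closure Ω) :=
    hcu.rpow_const fun _ _ => Or.inr hp.le
  obtain ⟨δ, hδ, hunif⟩ :=
    Metric.uniformContinuousOn_iff.1 (hK.uniformContinuousOn_of_continuous hcw) ε hε
  obtain ⟨D₀, hD₀⟩ := Metric.isBounded_iff.1 hK.isBounded
  set D := max D₀ 1
  have hD1 : 0 < D := lt_max_of_lt_right one_pos
  have hD : ∀ y ∈ closure Ω, ∀ z ∈ closure Ω, dist y z ≤ D := fun y hy z hz =>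
    (hD₀ hy hz).trans (le_max_left _ _)
  set s := min 1 (δ / (2 * D)) with hs
  have hs0 : 0 < s := lt_min one_pos (by positivity)
  have hs1 : s ≤ 1 := min_le_left _ _
  have hsD : s * D < δ := by
    calc s * D ≤ δ / (2 * D) * D := by gcongr; exact min_le_right _ _
      _ = δ / 2 := by field_simp
      _ < δ := half_lt_self hδ
  refine ⟨s * η, by positivity, fun ρ m x x' hxx' => ?_⟩
  have hx'0 : 0 ≤ rotationMeanFun p Ω u ρ m x' ^ p :=
    Real.rpow_nonneg (rotationMeanFun_nonneg hu0 x') p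
  rcases le_or_gt (rotationMeanFun p Ω u ρ m x ^ p) ε with hsmall | hbig
  · linarith
  have hsub := hball ρ m x hbig
  obtain ⟨y, hy, hyx, hyv⟩ := exists_rotationMeanFun_eq hp hb hcu hu0
    (hsub (mem_closedBall_self hη.le))
  -- The overshoot of `x'` whose interpolation with `x` at parameter `s` is `x'`; the bound `dist x
  -- x' ≤ s η` keeps it in the ball.
  have hz : x + s⁻¹ • (x' - x) ∈ closedMean Ω ρ m := hsub (by
    rw [mem_closedBall, dist_self_add_left, norm_smul, Real.norm_of_nonneg (inv_nonneg.2 hs0.le),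
      ← dist_eq_norm, dist_comm, inv_mul_le_iff₀ hs0]
    exact hxx')
  obtain ⟨z, hzc, hzx⟩ := hz
  set y' : Fin m → Eu n := y + s • (z - y) with hy'
  have hy'c : ∀ i, y' i ∈ closure Ω := fun i =>
    hc.closure.add_smul_sub_mem (hy i) (hzc i (mem_univ i)) ⟨hs0.le, hs1⟩
  have hy'x : meanMap ρ m y' = x' := by
    rw [hy', map_add, map_smul, map_sub, hyx, hzx, add_sub_cancel_left, smul_smul,
      mul_inv_cancel₀ hs0.ne', one_smul, add_sub_cancel]
  have hlow := avgPow_le_rotationMeanFun (ρ := ρ) hp hb hcu hu0 hy'c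
  rw [hy'x] at hlow
  have hdist : ∀ i, dist (y i) (y' i) < δ := by
    intro i
    have : y' i = y i + s • (z i - y i) := rfl
    rw [this, dist_self_add_right, norm_smul, Real.norm_of_nonneg hs0.le, ← dist_eq_norm]
    exact lt_of_le_of_lt (by gcongr; exact hD _ (hzc i (mem_univ i)) _ (hy i)) hsD
  have hcomp : avgPow p u y ≤ ε + 1 * avgPow p u y' := by
    refine one_div_mul_sum_le_add hε.le zero_le_one (fun i => ?_) le_rfl
    have := hunif _ (hy i) _ (hy'c i) (hdist i)
    rw [Real.dist_eq] at this
    linarith [(abs_lt.1 this).2]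
  rw [hyv]
  linarith

lemma exists_rpow_rotationMeanFun_le (hp : 0 < p) (hb : Bornology.IsBounded Ω)
    (hcu : ContinuousOn u (closure Ω)) (hu0 : ∀ x ∈ closure Ω, 0 ≤ u x) :
    ∃ M : ℝ, ∀ (ρ : ℕ → Rot n) (m : ℕ) (x : Eu n), rotationMeanFun p Ω u ρ m x ^ p ≤ M := by
  obtain ⟨M, hM⟩ := (isCompact_closure_of_isBounded hb).exists_bound_of_continuousOn
    (hcu.rpow_const fun _ _ => Or.inr hp.le : ContinuousOn (fun y => u y ^ p) (closure Ω))
  refine ⟨max M 0, fun ρ m x => ?_⟩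
  by_cases hx : x ∈ closedMean Ω ρ m
  · obtain ⟨y, hy, -, hyv⟩ := exists_rotationMeanFun_eq hp hb hcu hu0 hx
    rw [hyv]
    have := one_div_mul_sum_le_add (m := m) (f := fun i => u (y i) ^ p) (d := fun _ => 0)
      (a := max M 0) (C := 0) (b := 0) (le_max_right _ _) le_rfl (fun i => by
        have := hM _ (hy i)
        rw [Real.norm_eq_abs] at this
        linarith [le_abs_self (u (y i) ^ p), le_max_left M 0]) (by simp)
    rwa [zero_mul, add_zero] at this
  · rw [rotationMeanFun_of_notMem hx, Real.zero_rpow hp.ne']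
    exact le_max_right _ _

/-- The rotation means are uniformly equicontinuous and uniformly bounded. -/
lemma rotationMeanFun_equicontinuous (hp : 0 < p) (ho : IsOpen Ω)
    (hb : Bornology.IsBounded Ω) (hc : Convex ℝ Ω) (hne : Ω.Nonempty)
    (hcu : ContinuousOn u (closure Ω)) (hu0 : ∀ x ∈ closure Ω, 0 ≤ u x)
    (hbd : ∀ x ∈ frontier Ω, u x = 0) :
    (∃ M : ℝ, ∀ (ρ : ℕ → Rot n) (m : ℕ) (x : Eu n), |rotationMeanFun p Ω u ρ m x| ≤ M) ∧
    ∀ ε : ℝ, 0 < ε → ∃ δ : ℝ, 0 < δ ∧ ∀ (ρ : ℕ → Rot n) (m : ℕ) (x x' : Eu n), dist x x' < δ →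
      dist (rotationMeanFun p Ω u ρ m x) (rotationMeanFun p Ω u ρ m x') < ε := by
  obtain ⟨M, hM⟩ := exists_rpow_rotationMeanFun_le (p := p) hp hb hcu hu0
  have hnn : ∀ (ρ : ℕ → Rot n) (m : ℕ) (x : Eu n), 0 ≤ rotationMeanFun p Ω u ρ m x :=
    fun ρ m x => rotationMeanFun_nonneg hu0 x
  have hroot : ∀ (ρ : ℕ → Rot n) (m : ℕ) (x : Eu n),
      (rotationMeanFun p Ω u ρ m x ^ p) ^ p⁻¹ = rotationMeanFun p Ω u ρ m x :=
    fun ρ m x => Real.rpow_rpow_inv (hnn ρ m x) hp.ne'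
  refine ⟨⟨M ^ p⁻¹, fun ρ m x => ?_⟩, fun ε hε => ?_⟩
  · rw [abs_of_nonneg (hnn ρ m x), ← hroot]
    exact Real.rpow_le_rpow (Real.rpow_nonneg (hnn ρ m x) p) (hM ρ m x) (inv_nonneg.2 hp.le)
  -- Uniform continuity of the `p`-th root on `[0, M]` transfers the estimate from `p`-th powers to
  -- values.
  · have hcr : ContinuousOn (fun t : ℝ => t ^ p⁻¹) (Icc 0 M) :=
      continuousOn_id.rpow_const fun _ _ => Or.inr (inv_nonneg.2 hp.le)
    obtain ⟨δ, hδ, hunif⟩ := Metric.uniformContinuousOn_iff.1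
      (isCompact_Icc.uniformContinuousOn_of_continuous hcr) ε hε
    obtain ⟨δ', hδ', heq⟩ := exists_rpow_rotationMeanFun_le_add (p := p) hp ho hb hc hne hcu hu0
      hbd (half_pos hδ)
    refine ⟨δ', hδ', fun ρ m x x' hxx' => ?_⟩
    rw [← hroot ρ m x, ← hroot ρ m x']
    refine hunif _ ⟨Real.rpow_nonneg (hnn ρ m x) p, hM ρ m x⟩ _
      ⟨Real.rpow_nonneg (hnn ρ m x') p, hM ρ m x'⟩ ?_
    have h1 := heq ρ m x x' hxx'.le
    have h2 := heq ρ m x' x (by rw [dist_comm]; exact hxx'.le)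
    rw [Real.dist_eq, abs_lt]
    constructor <;> linarith

/-- Arzelà–Ascoli on `K`; the limit is extended by zero. -/
lemma exists_subseq_tendstoUniformlyOn {K : Set (Eu n)} (hK : IsCompact K) {f : ℕ → Eu n → ℝ}
    {M : ℝ} (hM : ∀ k x, |f k x| ≤ M)
    (heq : ∀ ε : ℝ, 0 < ε → ∃ δ : ℝ, 0 < δ ∧ ∀ k x x', dist x x' < δ → dist (f k x) (f k x') < ε) :
    ∃ (U : Eu n → ℝ) (φ : ℕ → ℕ), StrictMono φ ∧
      TendstoUniformlyOn (fun k => f (φ k)) U atTop K := by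
  classical
  have : CompactSpace K := isCompact_iff_compactSpace.1 hK
  have hcont : ∀ k, Continuous (f k) := fun k => Metric.continuous_iff.2 fun x ε hε => by
    obtain ⟨δ, hδ, h⟩ := heq ε hε
    exact ⟨δ, hδ, fun a ha => h k a x ha⟩
  let g : ℕ → BoundedContinuousFunction K ℝ := fun k =>
    BoundedContinuousFunction.mkOfCompact ⟨fun x => f k x, (hcont k).comp continuous_subtype_val⟩
  have hcomp : IsCompact (closure (range g)) := by
    refine BoundedContinuousFunction.arzela_ascoli (Icc (-M) M) isCompact_Icc _ ?_ ?_
    · rintro _ x ⟨k, rfl⟩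
      exact abs_le.1 (hM k x)
    · refine UniformEquicontinuous.equicontinuous
        (Metric.uniformEquicontinuous_iff.2 fun ε hε => ?_)
      obtain ⟨δ, hδ, h⟩ := heq ε hε
      refine ⟨δ, hδ, ?_⟩
      rintro x y hxy ⟨_, k, rfl⟩
      exact h k x y hxy
  obtain ⟨G, -, φ, hφ, hG⟩ := hcomp.tendsto_subseq fun k => subset_closure (mem_range_self k)
  refine ⟨fun x => if h : x ∈ K then G ⟨x, h⟩ else 0, φ, hφ, ?_⟩
  rw [BoundedContinuousFunction.tendsto_iff_tendstoUniformly] at hG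
  rw [tendstoUniformlyOn_iff_tendstoUniformly_comp_coe]
  convert hG using 1
  · rfl
  · ext x
    simp

/-- Mean width rearrangements exist along every sequence of rotations. -/
theorem exists_isRearrangement (hp : 0 < p) (ho : IsOpen Ω)
    (hb : Bornology.IsBounded Ω) (hc : Convex ℝ Ω) (hne : Ω.Nonempty)
    (hcu : ContinuousOn u (closure Ω)) (hu0 : ∀ x ∈ closure Ω, 0 ≤ u x)
    (hbd : ∀ x ∈ frontier Ω, u x = 0) (ρ : ℕ → Rot n) (c : Eu n) :
    ∃ U : Eu n → ℝ, IsRearrangement p Ω u ρ c U := by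
  obtain ⟨⟨M, hM⟩, heq⟩ := rotationMeanFun_equicontinuous (p := p) hp ho hb hc hne hcu hu0 hbd
  obtain ⟨U, φ, hφ, hU⟩ := exists_subseq_tendstoUniformlyOn
    (isCompact_closure_of_isBounded (isBounded_ball : Bornology.IsBounded (sharpBall Ω c)))
    (f := fun k => rotationMeanFun p Ω u ρ k) (hM ρ) (fun ε hε => by
      obtain ⟨δ, hδ, h⟩ := heq ε hε
      exact ⟨δ, hδ, h ρ⟩)
  exact ⟨U, φ, hφ, hU⟩

/-! ### Consequences of Hausdorff convergence -/

/-- Hausdorff closeness alone allows holes; convexity excludes them. For `y` near `x` and a unit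
`ξ`, the mean has a point within `R / 4` of `y + (R / 4) ξ`, so no direction separates `y` from the
mean. -/
lemma eventually_closedBall_subset_rotationMean (ho : IsOpen Ω) (hb : Bornology.IsBounded Ω)
    (hc : Convex ℝ Ω) (hne : Ω.Nonempty) {c : Eu n} (hsym : IsSymmetrizing Ω ρ c) {x : Eu n}
    (hx : x ∈ sharpBall Ω c) :
    ∃ r : ℝ, 0 < r ∧ ∀ᶠ m in atTop, closedBall x r ⊆ rotationMean Ω ρ m := by
  obtain ⟨R, hR, hball⟩ := Metric.isOpen_iff.1 (isOpen_ball : IsOpen (sharpBall Ω c)) x hx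
  refine ⟨R / 4, by positivity, ?_⟩
  have hr : 0 < R / 4 := by positivity
  filter_upwards [hsym.eventually (gt_mem_nhds (ENNReal.ofReal_pos.2 hr)), eventually_gt_atTop 0]
    with m hm hm0
  have hsub : ball x (R / 2) ⊆ closedMean Ω ρ m := by
    intro y hy
    refine mem_of_forall_exists_inner_le (convex_closedMean hc) (isCompact_closedMean hb).isClosed
      ((rotationMean_nonempty hne).mono rotationMean_subset_closedMean) fun ξ hξ => ?_
    have hmem : y + (R / 4) • ξ ∈ sharpBall Ω c := hball (by
      rw [mem_ball] at hy ⊢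
      calc dist (y + (R / 4) • ξ) x ≤ dist (y + (R / 4) • ξ) y + dist y x := dist_triangle _ _ _
        _ = R / 4 + dist y x := by
            rw [dist_self_add_left, norm_smul, hξ, mul_one, Real.norm_of_nonneg hr.le]
        _ < R := by linarith)
    rw [hausdorffEDist_comm] at hm
    obtain ⟨z, hz, hdz⟩ := exists_edist_lt_of_hausdorffEDist_lt hmem hm
    refine ⟨z, rotationMean_subset_closedMean hz, ?_⟩
    rw [edist_dist, ENNReal.ofReal_lt_ofReal_iff hr] at hdz
    have h1 := real_inner_le_norm ξ (y + (R / 4) • ξ - z)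
    rw [hξ, one_mul, ← dist_eq_norm, inner_sub_right, inner_add_right, inner_smul_right,
      real_inner_self_eq_norm_sq, hξ] at h1
    linarith
  intro y hy
  refine mem_rotationMean_of_ball_subset hm0 ho hb hc hne hr ((ball_subset_ball' ?_).trans hsub)
  rw [mem_closedBall] at hy
  linarith

/-- Where the mean function exceeds `ε`, a ball of radius `η` fits in the closed mean. About a point
outside the limit ball it would reach `η` farther out, contradicting a Hausdorff distance below `η`.
-/
lemma eventually_rotationMeanFun_le_of_notMem (hp : 0 < p) (ho : IsOpen Ω)
    (hb : Bornology.IsBounded Ω) (hc : Convex ℝ Ω) (hne : Ω.Nonempty)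
    (hcu : ContinuousOn u (closure Ω)) (hu0 : ∀ x ∈ closure Ω, 0 ≤ u x)
    (hbd : ∀ x ∈ frontier Ω, u x = 0) {c : Eu n} (hsym : IsSymmetrizing Ω ρ c)
    (hw : 0 < meanWidth Ω) {ε : ℝ} (hε : 0 < ε) :
    ∀ᶠ m in atTop, ∀ x ∉ sharpBall Ω c, rotationMeanFun p Ω u ρ m x ≤ ε := by
  obtain ⟨η, hη, hball⟩ := exists_closedBall_subset_closedMean hp ho hb hc hne hcu hu0 hbd
    (Real.rpow_pos_of_pos hε p)
  filter_upwards [hsym.eventually (gt_mem_nhds (ENNReal.ofReal_pos.2 hη))] with m hm x hx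
  by_contra! hlt
  have hsub := hball ρ m x (Real.rpow_lt_rpow hε.le hlt hp)
  have hxc : meanWidth Ω / 2 ≤ ‖x - c‖ := by
    rw [sharpBall, mem_ball, not_lt, dist_eq_norm] at hx
    exact hx
  have hxc0 : 0 < ‖x - c‖ := by linarith
  set e := ‖x - c‖⁻¹ • (x - c)
  have he : ‖e‖ = 1 := by rw [norm_smul, norm_inv, norm_norm, inv_mul_cancel₀ hxc0.ne']
  have hq : x + η • e ∈ closedMean Ω ρ m := hsub (by
    rw [mem_closedBall, dist_self_add_left, norm_smul, he, mul_one, Real.norm_of_nonneg hη.le])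
  rw [← hausdorffEDist_closure_left, closure_rotationMean hb] at hm
  obtain ⟨z, hz, hdz⟩ := exists_edist_lt_of_hausdorffEDist_lt hq hm
  rw [edist_dist, ENNReal.ofReal_lt_ofReal_iff hη] at hdz
  rw [sharpBall, mem_ball] at hz
  have h1 : dist (x + η • e) c = ‖x - c‖ + η := by
    have : x + η • e - c = (1 + η * ‖x - c‖⁻¹) • (x - c) := by
      rw [add_smul, one_smul, mul_smul]; abel
    rw [dist_eq_norm, this, norm_smul, Real.norm_of_nonneg (by positivity)]
    field_simp
  have h2 := dist_triangle (x + η • e) z c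
  linarith

end

section

variable {n : ℕ} {Ω : Set (Eu n)} {u : Eu n → ℝ} {p : ℝ} {ρ : ℕ → Rot n} {m : ℕ}

/-! ### Maximizers are interior -/

/-- The derivative of `u` along `z - y` is at least `κ` near `y`, so the mean value inequality gives
linear growth from the boundary value `0`. -/
lemma exists_mul_le_along_inward (ho : IsOpen Ω) (hc : Convex ℝ Ω)
    (hcu : ContinuousOn u (closure Ω)) (hdiff : DifferentiableOn ℝ u Ω)
    (hbd : ∀ x ∈ frontier Ω, u x = 0) (hslope : HasPositiveInwardSlope Ω u) {y z : Eu n}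
    (hy : y ∈ frontier Ω) (hz : z ∈ Ω) :
    ∃ κ : ℝ, 0 < κ ∧ ∀ᶠ s in 𝓝[>] (0 : ℝ), κ * s ≤ u (y + s • (z - y)) := by
  obtain ⟨κ, hκ, hev⟩ := hslope y hy (z - y) ⟨1, one_pos, by simpa using hz⟩
  obtain ⟨r, hr, hball⟩ := Metric.mem_nhdsWithin_iff.1 hev
  have hyc := frontier_subset_closure hy
  have hin : ∀ s ∈ Ioc (0 : ℝ) 1, y + s • (z - y) ∈ Ω := fun s hs => by
    have := hc.add_smul_sub_mem_interior' hyc (by rwa [ho.interior_eq]) hs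
    rwa [ho.interior_eq] at this
  -- Keeps the segment within the radius where the derivative bound holds; the `+ 1` avoids division
  -- by zero.
  set s₀ := min 1 (r / (‖z - y‖ + 1)) with hs₀
  have hs₀0 : 0 < s₀ := lt_min one_pos (by positivity)
  have hder : ∀ s ∈ Ioc (0 : ℝ) 1,
      HasDerivAt (fun s : ℝ => u (y + s • (z - y))) (fderiv ℝ u (y + s • (z - y)) (z - y)) s := by
    intro s hs
    have h1 : HasDerivAt (fun s : ℝ => y + s • (z - y)) (z - y) s := by
      simpa using ((hasDerivAt_id s).smul_const (z - y)).const_add y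
    exact ((hdiff.differentiableAt (ho.mem_nhds (hin s hs))).hasFDerivAt.comp_hasDerivAt s h1)
  refine ⟨κ, hκ, ?_⟩
  filter_upwards [Ioo_mem_nhdsGT hs₀0] with s hs
  have hs1 : s ≤ 1 := hs.2.le.trans (min_le_left _ _)
  have key := (convex_Icc (0 : ℝ) s).mul_sub_le_image_sub_of_le_deriv
    (f := fun s : ℝ => u (y + s • (z - y))) (C := κ) ?_ ?_ ?_ 0 ⟨le_rfl, hs.1.le⟩ s
    ⟨hs.1.le, le_rfl⟩ hs.1.le
  · rw [zero_smul, add_zero, hbd y hy] at key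
    simpa using key
  · refine hcu.comp (by fun_prop) fun t ht => ?_
    rcases ht.1.eq_or_lt with h | h
    · rw [← h, zero_smul, add_zero]; exact hyc
    · exact subset_closure (hin t ⟨h, ht.2.trans hs1⟩)
  · intro t ht
    rw [interior_Icc] at ht
    exact (hder t ⟨ht.1, ht.2.le.trans hs1⟩).differentiableAt.differentiableWithinAt
  · intro t ht
    rw [interior_Icc] at ht
    have htI : t ∈ Ioc (0 : ℝ) 1 := ⟨ht.1, ht.2.le.trans hs1⟩
    rw [(hder t htI).deriv]
    refine hball ⟨?_, hin t htI⟩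
    rw [mem_ball, dist_self_add_left, norm_smul, Real.norm_of_nonneg ht.1.le]
    have h1 : t < r / (‖z - y‖ + 1) := (ht.2.trans hs.2).trans_le (min_le_right _ _)
    rw [lt_div_iff₀ (by positivity)] at h1
    nlinarith [ht.1]

/-- For `p < 1`, points that realize the rotation mean at an interior point are interior. -/
lemma mem_of_rotationMeanFun_eq (hp0 : 0 < p) (hp1 : p < 1) (ho : IsOpen Ω)
    (hb : Bornology.IsBounded Ω) (hc : Convex ℝ Ω)
    (hcu : ContinuousOn u (closure Ω)) (hdiff : DifferentiableOn ℝ u Ω)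
    (hbd : ∀ x ∈ frontier Ω, u x = 0) (hpos : ∀ x ∈ Ω, 0 < u x)
    (hu0 : ∀ x ∈ closure Ω, 0 ≤ u x) (hslope : HasPositiveInwardSlope Ω u)
    {y : Fin m → Eu n} (hm : 0 < m) (hy : ∀ i, y i ∈ closure Ω)
    (hx : meanMap ρ m y ∈ rotationMean Ω ρ m)
    (hv : rotationMeanFun p Ω u ρ m (meanMap ρ m y) ^ p = avgPow p u y) (j : Fin m) :
    y j ∈ Ω := by
  have hfr : ∀ i, y i ∉ Ω → y i ∈ frontier Ω := fun i hi => ⟨hy i, by rwa [ho.interior_eq]⟩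
  rw [rotationMean_eq_image] at hx
  obtain ⟨z, hz, hzx⟩ := hx
  have hz' : ∀ i, z i ∈ Ω := fun i => hz i (mem_univ i)
  by_contra hj
  -- An interior component loses at most order `s`, since `u ^ p` is differentiable where `u > 0`; a
  -- boundary component starts at `0` and cannot lose.
  have hlow : ∀ i, ∃ C : ℝ, 0 ≤ C ∧ ∀ᶠ s in 𝓝[>] (0 : ℝ),
      u (y i) ^ p - C * s ≤ u (y i + s • (z i - y i)) ^ p := by
    intro i
    by_cases hi : y i ∈ Ω
    · have hd : DifferentiableAt ℝ (fun s : ℝ => u (y i + s • (z i - y i)) ^ p) 0 := by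
        refine DifferentiableAt.rpow_const ?_ (Or.inl ?_)
        · refine DifferentiableAt.comp (g := u) (0 : ℝ) ?_ (by fun_prop)
          rw [zero_smul, add_zero]
          exact hdiff.differentiableAt (ho.mem_nhds hi)
        · rw [zero_smul, add_zero]
          exact (hpos _ hi).ne'
      obtain ⟨C, hC, hCb⟩ := hd.isBigO_sub.exists_nonneg
      refine ⟨C, hC, ?_⟩
      filter_upwards [nhdsWithin_le_nhds hCb.bound, self_mem_nhdsWithin] with s hs hs0
      rw [zero_smul, add_zero, sub_zero, Real.norm_eq_abs, Real.norm_of_nonneg (le_of_lt hs0)] at hs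
      linarith [(abs_le.1 hs).1]
    · refine ⟨0, le_rfl, ?_⟩
      filter_upwards [Ioo_mem_nhdsGT one_pos] with s hs
      rw [hbd _ (hfr i hi), Real.zero_rpow hp0.ne', zero_mul, sub_zero]
      exact Real.rpow_nonneg (hu0 _ (hc.closure.add_smul_sub_mem (hy i)
        (subset_closure (hz' i)) ⟨hs.1.le, hs.2.le⟩)) _
  choose C hC0 hCev using hlow
  obtain ⟨κ, hκ, hκev⟩ :=
    exists_mul_le_along_inward ho hc hcu hdiff hbd hslope (hfr j hj) (hz' j)
  -- The tuples `y` and `z` have the same image, so sliding towards `z` keeps the mean point fixed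
  -- and cannot beat the maximum.
  have hupper : ∀ s ∈ Ioo (0 : ℝ) 1, ∑ i, u (y i + s • (z i - y i)) ^ p ≤ ∑ i, u (y i) ^ p := by
    intro s hs
    have h1 := avgPow_le_rotationMeanFun (ρ := ρ) (p := p) hp0 hb hcu hu0
      (y := y + s • (z - y)) fun i => hc.closure.add_smul_sub_mem (hy i)
        (subset_closure (hz' i)) ⟨hs.1.le, hs.2.le⟩
    rw [map_add, map_smul, map_sub, hzx, sub_self, smul_zero, add_zero, hv] at h1
    exact le_of_mul_le_mul_left h1 (by positivity)
  set S := ∑ i, C i with hS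
  -- The gain of the boundary component `j` is at most the total loss; dividing by `s ^ p` and
  -- letting `s → 0` contradicts `κ > 0`.
  have hfinal : ∀ᶠ s in 𝓝[>] (0 : ℝ), κ ^ p * s ^ p ≤ S * s := by
    filter_upwards [eventually_all.2 hCev, hκev, Ioo_mem_nhdsGT one_pos] with s hs1 hs2 hs3
    have h1 : ∀ i, u (y i) ^ p + (if i = j then κ ^ p * s ^ p else 0) - C i * s ≤
        u (y i + s • (z i - y i)) ^ p := by
      intro i
      split_ifs with hij
      · subst hij
        rw [hbd _ (hfr i hj), Real.zero_rpow hp0.ne', ← Real.mul_rpow hκ.le hs3.1.le]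
        have h2 := Real.rpow_le_rpow (mul_nonneg hκ.le hs3.1.le) hs2 hp0.le
        have h3 := mul_nonneg (hC0 i) hs3.1.le
        linarith
      · linarith [hs1 i]
    have h2 := (Finset.sum_le_sum fun i (_ : i ∈ Finset.univ) => h1 i).trans (hupper s hs3)
    rw [Finset.sum_sub_distrib, Finset.sum_add_distrib, ← Finset.sum_mul] at h2
    simp only [Finset.sum_ite_eq', Finset.mem_univ, if_true] at h2
    linarith
  have hlim : Tendsto (fun s : ℝ => S * s ^ (1 - p)) (𝓝[>] 0) (𝓝 0) := by
    have h1 : ContinuousAt (fun s : ℝ => S * s ^ (1 - p)) 0 :=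
      continuousAt_const.mul (Real.continuousAt_rpow_const _ _ (Or.inr (by linarith)))
    have h2 := h1.tendsto.mono_left (nhdsWithin_le_nhds (s := Ioi 0))
    rwa [Real.zero_rpow (by linarith), mul_zero] at h2
  have hge : ∀ᶠ s in 𝓝[>] (0 : ℝ), κ ^ p ≤ S * s ^ (1 - p) := by
    filter_upwards [hfinal, self_mem_nhdsWithin] with s hs hs0
    have hs0' : 0 < s := hs0
    have h1 : S * s = S * s ^ (1 - p) * s ^ p := by
      rw [mul_assoc, ← Real.rpow_add hs0']; simp
    rw [h1] at hs
    exact le_of_mul_le_mul_right hs (Real.rpow_pos_of_pos hs0' p)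
  have := ge_of_tendsto hlim hge
  linarith [Real.rpow_pos_of_pos hκ p]

/-! ### Second order expansions along lines -/

/-- `f` has value `a`, first derivative `b` and second derivative `c` at `0`. -/
def TwoJet (f : ℝ → ℝ) (a b c : ℝ) : Prop :=
  f 0 = a ∧ ∃ f' : ℝ → ℝ, (∀ᶠ t in 𝓝 0, HasDerivAt f (f' t) t) ∧ f' 0 = b ∧ HasDerivAt f' c 0

lemma TwoJet.sub {f g : ℝ → ℝ} {a b c a' b' c' : ℝ} (hf : TwoJet f a b c)
    (hg : TwoJet g a' b' c') : TwoJet (fun t => f t - g t) (a - a') (b - b') (c - c') := by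
  obtain ⟨hf0, f', hf1, hf2, hf3⟩ := hf
  obtain ⟨hg0, g', hg1, hg2, hg3⟩ := hg
  refine ⟨by simp only [hf0, hg0], fun t => f' t - g' t, ?_, by simp only [hf2, hg2], hf3.sub hg3⟩
  filter_upwards [hf1, hg1] with t h1 h2 using h1.sub h2

lemma TwoJet.add_const {f : ℝ → ℝ} {a b c : ℝ} (hf : TwoJet f a b c) (k : ℝ) :
    TwoJet (fun t => f t + k) (a + k) b c := by
  obtain ⟨hf0, f', hf1, hf2, hf3⟩ := hf
  exact ⟨by simp only [hf0], f', hf1.mono fun t h => h.add_const k, hf2, hf3⟩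

lemma TwoJet.const_mul {f : ℝ → ℝ} {a b c : ℝ} (hf : TwoJet f a b c) (k : ℝ) :
    TwoJet (fun t => k * f t) (k * a) (k * b) (k * c) := by
  obtain ⟨hf0, f', hf1, hf2, hf3⟩ := hf
  exact ⟨by simp only [hf0], fun t => k * f' t, hf1.mono fun t h => h.const_mul k,
    by simp only [hf2], hf3.const_mul k⟩

lemma TwoJet.sum {ι : Type*} [Fintype ι] {f : ι → ℝ → ℝ} {a b c : ι → ℝ}
    (hf : ∀ i, TwoJet (f i) (a i) (b i) (c i)) :
    TwoJet (fun t => ∑ i, f i t) (∑ i, a i) (∑ i, b i) (∑ i, c i) := by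
  choose hf0 f' hf1 hf2 hf3 using hf
  refine ⟨Finset.sum_congr rfl fun i _ => hf0 i, fun t => ∑ i, f' i t, ?_,
    Finset.sum_congr rfl fun i _ => hf2 i, HasDerivAt.fun_sum fun i _ => hf3 i⟩
  filter_upwards [eventually_all.2 hf1] with t ht using HasDerivAt.fun_sum fun i _ => ht i

lemma TwoJet.rpow {f : ℝ → ℝ} {a b c : ℝ} (hf : TwoJet f a b c) (ha : 0 < a) (p : ℝ) :
    TwoJet (fun t => f t ^ p) (a ^ p) (p * a ^ (p - 1) * b)
      (p * a ^ (p - 1) * c + p * (p - 1) * a ^ (p - 2) * b ^ 2) := by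
  obtain ⟨hf0, f', hf1, hf2, hf3⟩ := hf
  have hd0 : HasDerivAt f b 0 := hf2 ▸ hf1.self_of_nhds
  have hpos : ∀ᶠ t in 𝓝 0, 0 < f t :=
    hd0.continuousAt.eventually (lt_mem_nhds (by rwa [hf0]))
  refine ⟨by simp only [hf0], fun t => f' t * p * f t ^ (p - 1), ?_, by simp only [hf0, hf2]; ring,
    ?_⟩
  · filter_upwards [hf1, hpos] with t h1 h2 using h1.rpow_const (Or.inl h2.ne')
  · have h1 := (hf3.mul_const p).mul (hd0.rpow_const (p := p - 1) (Or.inl (by rw [hf0]; exact ha.ne')))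
    refine h1.congr_deriv ?_
    rw [hf0, hf2, show p - 1 - 1 = p - 2 by ring]
    ring

/-- Were `c` positive, the second derivative test would make `0` a local minimum as well, so `f`
would be locally constant and `c = 0`. -/
lemma TwoJet.of_isLocalMax {f : ℝ → ℝ} {a b c : ℝ} (hf : TwoJet f a b c)
    (hmax : IsLocalMax f 0) : b = 0 ∧ c ≤ 0 := by
  obtain ⟨hf0, f', hf1, hf2, hf3⟩ := hf
  have hd0 : HasDerivAt f b 0 := hf2 ▸ hf1.self_of_nhds
  have hb : b = 0 := hmax.hasDerivAt_eq_zero hd0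
  refine ⟨hb, ?_⟩
  by_contra! hc
  have hderiv : deriv f =ᶠ[𝓝 0] f' := hf1.mono fun t h => h.deriv
  have hdd : deriv (deriv f) 0 = c := by rw [hderiv.deriv_eq, hf3.deriv]
  have hmin : IsLocalMin f 0 := isLocalMin_of_deriv_deriv_pos (by rw [hdd]; exact hc)
    (by rw [hd0.deriv, hb]) hd0.continuousAt
  have hconst : f =ᶠ[𝓝 0] fun _ => f 0 := by
    filter_upwards [hmax, hmin] with t h1 h2 using le_antisymm h1 h2
  have h2 : deriv (deriv f) 0 = 0 := by
    rw [hconst.deriv.deriv_eq]; simp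
  linarith

lemma twoJet_of_contDiffAt {u : Eu n → ℝ} {x : Eu n} (hu : ContDiffAt ℝ 2 u x) (v : Eu n) :
    TwoJet (fun t : ℝ => u (x + t • v)) (u x) (fderiv ℝ u x v)
      (fderiv ℝ (fderiv ℝ u) x v v) := by
  have hline : ∀ t : ℝ, HasDerivAt (fun t : ℝ => x + t • v) v t := fun t => by
    simpa using ((hasDerivAt_id t).smul_const v).const_add x
  have hev : ∀ᶠ y in 𝓝 x, DifferentiableAt ℝ u y :=
    (hu.eventually (by simp)).mono fun y hy => hy.differentiableAt (by simp)
  have htend : Tendsto (fun t : ℝ => x + t • v) (𝓝 0) (𝓝 x) := by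
    have := (hline 0).continuousAt.tendsto
    rwa [zero_smul, add_zero] at this
  refine ⟨by simp, fun t => fderiv ℝ u (x + t • v) v, ?_, by simp, ?_⟩
  · filter_upwards [htend.eventually hev] with t ht
    exact ht.hasFDerivAt.comp_hasDerivAt t (hline t)
  · have h1 : DifferentiableAt ℝ (fderiv ℝ u) x :=
      (hu.fderiv_right (m := 1) (by norm_num)).differentiableAt (by simp)
    have h2 : HasFDerivAt (fderiv ℝ u) (fderiv ℝ (fderiv ℝ u) x) (x + (0 : ℝ) • v) := by
      rw [zero_smul, add_zero]; exact h1.hasFDerivAt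
    have h3 := h2.comp_hasDerivAt (0 : ℝ) (hline 0)
    have h4 := h3.clm_apply (hasDerivAt_const (0 : ℝ) v)
    simpa using h4

/-! ### Hessians and gradients -/

lemma inner_gradient (u : Eu n → ℝ) (x v : Eu n) :
    inner ℝ (gradient u x) v = fderiv ℝ u x v := by
  rw [← toDual_gradient, InnerProductSpace.toDual_apply_apply]

lemma hessian_isSymm {u : Eu n → ℝ} {x : Eu n} (hu : ContDiffAt ℝ 2 u x) :
    (hessian u x).IsSymm := by
  ext i j
  exact (hu.isSymmSndFDerivAt (by simp)).eq _ _

lemma dotProduct_hessian_mulVec (u : Eu n → ℝ) (x v : Eu n) :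
    v.ofLp ⬝ᵥ (hessian u x).mulVec v.ofLp = fderiv ℝ (fderiv ℝ u) x v v := by
  have hv : v = ∑ i, v i • EuclideanSpace.single i (1 : ℝ) := by
    conv_lhs => rw [← (EuclideanSpace.basisFun (Fin n) ℝ).sum_repr v]
    simp
  conv_rhs => rw [hv]
  simp only [map_sum, map_smul, sum_apply, smul_apply,
    smul_eq_mul, dotProduct, Matrix.mulVec, hessian, Matrix.of_apply, Finset.mul_sum]
  rw [Finset.sum_comm]
  refine Finset.sum_congr rfl fun i _ => Finset.sum_congr rfl fun j _ => ?_
  ring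

lemma dotProduct_conj_mulVec (ρ : Rot n) (A : Mat n) (v : Eu n) :
    v.ofLp ⬝ᵥ ((ρ : Mat n) * A * (ρ : Mat n).transpose).mulVec v.ofLp =
      (rot ρ⁻¹ v).ofLp ⬝ᵥ A.mulVec (rot ρ⁻¹ v).ofLp := by
  have h : (rot ρ⁻¹ v).ofLp = (ρ : Mat n).transpose.mulVec v.ofLp := by
    simp [rot, coe_inv_rot, Matrix.toLpLin_apply]
  rw [h, ← Matrix.mulVec_mulVec, ← Matrix.mulVec_mulVec, Matrix.dotProduct_mulVec,
    ← Matrix.mulVec_transpose]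

end

section

variable {n : ℕ} {Ω : Set (Eu n)} {u : Eu n → ℝ} {p : ℝ} {ρ : ℕ → Rot n} {m : ℕ}

/-! ### Rotation means are viscosity subsolutions -/

/-- First and second order conditions at a point where a smooth function touches the rotation mean
from above. -/
lemma jet_conditions (hp0 : 0 < p) (ho : IsOpen Ω) (hb : Bornology.IsBounded Ω)
    (hcu : ContinuousOn u (closure Ω)) (hC2 : ContDiffOn ℝ 2 u Ω) (hpos : ∀ x ∈ Ω, 0 < u x)
    (hu0 : ∀ x ∈ closure Ω, 0 ≤ u x) {y : Fin m → Eu n} (hy : ∀ i, y i ∈ Ω)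
    {b : ℝ} (hb0 : 0 < b) (hbv : rotationMeanFun p Ω u ρ m (meanMap ρ m y) = b)
    (hv : b ^ p = avgPow p u y) {φ : Eu n → ℝ}
    (hφ : ContDiffAt ℝ 2 φ (meanMap ρ m y))
    (hmax : IsLocalMax (fun z => rotationMeanFun p Ω u ρ m z - φ z) (meanMap ρ m y))
    (η : Fin m → Eu n) :
    (1 / (m : ℝ)) * ∑ i, p * u (y i) ^ (p - 1) * fderiv ℝ u (y i) (η i) =
      p * b ^ (p - 1) * fderiv ℝ φ (meanMap ρ m y) (meanMap ρ m η) ∧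
    (1 / (m : ℝ)) * ∑ i, (p * u (y i) ^ (p - 1) * fderiv ℝ (fderiv ℝ u) (y i) (η i) (η i) +
        p * (p - 1) * u (y i) ^ (p - 2) * fderiv ℝ u (y i) (η i) ^ 2) ≤
      p * b ^ (p - 1) * fderiv ℝ (fderiv ℝ φ) (meanMap ρ m y) (meanMap ρ m η) (meanMap ρ m η) +
        p * (p - 1) * b ^ (p - 2) * fderiv ℝ φ (meanMap ρ m y) (meanMap ρ m η) ^ 2 := by
  set x := meanMap ρ m y with hx
  set ζ := meanMap ρ m η with hζ
  have hjet1 : TwoJet (fun t : ℝ => avgPow p u (y + t • η)) _ _ _ :=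
    (TwoJet.sum fun i => (twoJet_of_contDiffAt (hC2.contDiffAt (ho.mem_nhds (hy i)))
      (η i)).rpow (hpos _ (hy i)) p).const_mul (1 / (m : ℝ))
  -- Shifted to take the value `b > 0` at `x`, the test function has a twice differentiable `p`-th
  -- power along the line near `t = 0`.
  have hjet2 := (twoJet_of_contDiffAt hφ ζ).add_const (b - φ x)
  rw [add_sub_cancel] at hjet2
  have hjet := hjet1.sub (hjet2.rpow hb0 p)
  have htend : Tendsto (fun t : ℝ => x + t • ζ) (𝓝 0) (𝓝 x) := by
    have : ContinuousAt (fun t : ℝ => x + t • ζ) 0 := by fun_prop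
    have := this.tendsto
    rwa [zero_smul, add_zero] at this
  have hin : ∀ᶠ t : ℝ in 𝓝 0, ∀ i, y i + t • η i ∈ Ω := by
    refine eventually_all.2 fun i => ?_
    have h1 : ContinuousAt (fun t : ℝ => y i + t • η i) 0 := by fun_prop
    exact h1.eventually (ho.mem_nhds (by simpa using hy i))
  -- The perturbed tuple competes at the perturbed point, where the mean lies below the shifted test
  -- function; equality holds at `t = 0`.
  have hlm : IsLocalMax (fun t : ℝ => avgPow p u (y + t • η) - (φ (x + t • ζ) + (b - φ x)) ^ p)
      0 := by
    have h0 : avgPow p u (y + (0 : ℝ) • η) - (φ (x + (0 : ℝ) • ζ) + (b - φ x)) ^ p = 0 := by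
      rw [zero_smul, zero_smul, add_zero, add_zero, add_sub_cancel, hv, sub_self]
    filter_upwards [htend.eventually hmax, hin] with t ht htin
    rw [h0, sub_nonpos]
    have h1 := avgPow_le_rotationMeanFun (ρ := ρ) (p := p) hp0 hb hcu hu0 (y := y + t • η)
      fun i => subset_closure (htin i)
    rw [map_add, map_smul, ← hx, ← hζ] at h1
    refine h1.trans (Real.rpow_le_rpow (rotationMeanFun_nonneg hu0 _) ?_ hp0.le)
    rw [hbv] at ht
    linarith
  obtain ⟨h1, h2⟩ := hjet.of_isLocalMax hlm
  exact ⟨sub_eq_zero.1 h1, sub_nonpos.1 h2⟩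

/-- The rotation mean of a solution satisfies the viscosity inequality at interior points. -/
lemma rotationMeanFun_subsolution {F : Operator n} (hFell : IsDegenerateElliptic F)
    (hFrot : IsRotationInvariant F) (hp0 : 0 < p) (hp1 : p < 1)
    (hG : ∀ θ : Eu n, Convex ℝ (superlevelG F p θ)) (ho : IsOpen Ω)
    (hb : Bornology.IsBounded Ω) (hc : Convex ℝ Ω) (hu : IsClassicalSolution F Ω u)
    (hu0 : ∀ x ∈ closure Ω, 0 ≤ u x) (hslope : HasPositiveInwardSlope Ω u) (hm : 0 < m)
    {x : Eu n} (hx : x ∈ rotationMean Ω ρ m) {φ : Eu n → ℝ} (hφ : ContDiffAt ℝ 2 φ x)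
    (hmax : IsLocalMax (fun z => rotationMeanFun p Ω u ρ m z - φ z) x) :
    0 ≤ F x (rotationMeanFun p Ω u ρ m x) (gradient φ x) (hessian φ x) := by
  obtain ⟨y, hyc, hyx, hv⟩ := exists_rotationMeanFun_eq (p := p) hp0 hb hu.continuousOn hu0
    (rotationMean_subset_closedMean hx)
  subst hyx
  have hy : ∀ i, y i ∈ Ω := mem_of_rotationMeanFun_eq hp0 hp1 ho hb hc hu.continuousOn
    (hu.contDiffOn.differentiableOn (by simp)) hu.boundary hu.pos hu0 hslope hm hyc hx hv
  have hm' : (0 : ℝ) < m := by exact_mod_cast hm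
  have ha : ∀ i, 0 < u (y i) := fun i => hu.pos _ (hy i)
  have : Nonempty (Fin m) := ⟨⟨0, hm⟩⟩
  have hT : 0 < avgPow p u y := mul_pos (by positivity)
    (Finset.sum_pos (fun i _ => Real.rpow_pos_of_pos (ha i) p) Finset.univ_nonempty)
  set b := rotationMeanFun p Ω u ρ m (meanMap ρ m y) with hbdef
  have hb0 : 0 < b := by
    refine lt_of_le_of_ne (rotationMeanFun_nonneg hu0 _) fun h => ?_
    rw [← h, Real.zero_rpow hp0.ne'] at hv
    linarith
  set x := meanMap ρ m y with hxdef
  have jets := jet_conditions hp0 ho hb hu.continuousOn hu.contDiffOn hu.pos hu0 hy hb0 hbdef.symm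
    hv hφ hmax
  -- Moving only the `i`-th component moves the mean point by `ζ / m`.
  have first : ∀ (i : Fin m) (ζ : Eu n), u (y i) ^ (p - 1) * fderiv ℝ u (y i) (rot (ρ i)⁻¹ ζ) =
      b ^ (p - 1) * fderiv ℝ φ x ζ := by
    intro i ζ
    have h1 := (jets (Pi.single i (rot (ρ i)⁻¹ ζ))).1
    have h2 : meanMap ρ m (Pi.single i (rot (ρ i)⁻¹ ζ)) = (1 / (m : ℝ)) • ζ := by
      rw [meanMap_apply, Finset.sum_eq_single i]
      · simp
      · intro j _ hj
        rw [Pi.single_eq_of_ne hj]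
        exact map_zero (rotEquiv (ρ j))
      · simp
    rw [h2, Finset.sum_eq_single i, Pi.single_eq_same, map_smul, smul_eq_mul] at h1
    · have h3 : (1 / (m : ℝ)) * p ≠ 0 := by positivity
      apply mul_left_cancel₀ h3
      linear_combination h1
    · intro j _ hj
      rw [Pi.single_eq_of_ne hj, map_zero, mul_zero]
    · simp
  have second : ∀ ζ : Eu n, b ^ (1 - 3 * p) * ((1 / (m : ℝ)) * ∑ i, u (y i) ^ (3 * p - 1) *
      fderiv ℝ (fderiv ℝ u) (y i) (rot (ρ i)⁻¹ ζ) (rot (ρ i)⁻¹ ζ)) ≤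
      fderiv ℝ (fderiv ℝ φ) x ζ ζ := by
    intro ζ
    -- These weights have mean `1`, so the mean point moves by exactly `ζ`. By the first order
    -- condition the squared gradient terms of the two sides then coincide and cancel.
    set r : Fin m → ℝ := fun i => u (y i) ^ p / b ^ p with hr
    have hbp : 0 < b ^ p := Real.rpow_pos_of_pos hb0 p
    have hsumr : (1 / (m : ℝ)) * ∑ i, u (y i) ^ p = b ^ p := hv.symm
    have h1 := (jets fun i => r i • rot (ρ i)⁻¹ ζ).2
    have h2 : meanMap ρ m (fun i => r i • rot (ρ i)⁻¹ ζ) = ζ := by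
      rw [meanMap_apply]
      simp only [rot_smul, rot_rot_inv]
      rw [← Finset.sum_smul, smul_smul, hr, ← Finset.sum_div, ← mul_div_assoc, hsumr,
        div_self hbp.ne', one_smul]
    rw [h2] at h1
    set L := fderiv ℝ φ x ζ with hL
    set Q := fderiv ℝ (fderiv ℝ φ) x ζ ζ with hQ
    set lam := b ^ (p - 1) * L with hlam
    have hterm : ∀ i, p * u (y i) ^ (p - 1) * fderiv ℝ (fderiv ℝ u) (y i)
        (r i • rot (ρ i)⁻¹ ζ) (r i • rot (ρ i)⁻¹ ζ) +
        p * (p - 1) * u (y i) ^ (p - 2) * fderiv ℝ u (y i) (r i • rot (ρ i)⁻¹ ζ) ^ 2 =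
        p / (b ^ p) ^ 2 * (u (y i) ^ (3 * p - 1) *
          fderiv ℝ (fderiv ℝ u) (y i) (rot (ρ i)⁻¹ ζ) (rot (ρ i)⁻¹ ζ)) +
        p * (p - 1) * lam ^ 2 / (b ^ p) ^ 2 * u (y i) ^ p := by
      intro i
      have hai := ha i
      have e1 : u (y i) ^ (3 * p - 1) = u (y i) ^ (p - 1) * (u (y i) ^ p) ^ 2 := by
        rw [sq, ← Real.rpow_add hai, ← Real.rpow_add hai]; congr 1; ring
      have e2 : u (y i) ^ (p - 2) * u (y i) ^ p = (u (y i) ^ (p - 1)) ^ 2 := by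
        rw [sq, ← Real.rpow_add hai, ← Real.rpow_add hai]
        congr 1; ring
      have e3 := first i ζ
      rw [← hL, ← hlam] at e3
      simp only [map_smul, smul_apply, smul_eq_mul, hr]
      rw [e1, ← e3]
      field_simp
      linear_combination (p - 1) * fderiv ℝ u (y i) (rot (ρ i)⁻¹ ζ) ^ 2 * e2
    simp only [hterm] at h1
    rw [Finset.sum_add_distrib, ← Finset.mul_sum, ← Finset.mul_sum] at h1
    have e4 : p * (p - 1) * b ^ (p - 2) * L ^ 2 = p * (p - 1) * lam ^ 2 / b ^ p := by
      have : b ^ (p - 2) * b ^ p = (b ^ (p - 1)) ^ 2 := by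
        rw [sq, ← Real.rpow_add hb0, ← Real.rpow_add hb0]; congr 1; ring
      rw [hlam, eq_div_iff hbp.ne']
      linear_combination p * (p - 1) * L ^ 2 * this
    set q := ∑ i, u (y i) ^ (3 * p - 1) *
      fderiv ℝ (fderiv ℝ u) (y i) (rot (ρ i)⁻¹ ζ) (rot (ρ i)⁻¹ ζ)
    have e5 : (1 / (m : ℝ)) * (p / (b ^ p) ^ 2 * q +
        p * (p - 1) * lam ^ 2 / (b ^ p) ^ 2 * ∑ i, u (y i) ^ p) =
        p / (b ^ p) ^ 2 * ((1 / (m : ℝ)) * q) + p * (p - 1) * lam ^ 2 / b ^ p := by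
      have : p * (p - 1) * lam ^ 2 / b ^ p =
          p * (p - 1) * lam ^ 2 / (b ^ p) ^ 2 * ((1 / (m : ℝ)) * ∑ i, u (y i) ^ p) := by
        rw [hsumr]; field_simp
      rw [this]; ring
    rw [e4, e5] at h1
    have h6 : p / (b ^ p) ^ 2 * ((1 / (m : ℝ)) * q) ≤ p * b ^ (p - 1) * Q := by linarith
    have e7 : b ^ (1 - 3 * p) = ((b ^ p) ^ 2)⁻¹ * (b ^ (p - 1))⁻¹ := by
      rw [← mul_inv, sq, ← Real.rpow_add hb0, ← Real.rpow_add hb0, ← Real.rpow_neg hb0.le]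
      congr 1; ring
    have hbq : 0 < b ^ (p - 1) := Real.rpow_pos_of_pos hb0 _
    have h8 : ((b ^ p) ^ 2)⁻¹ * ((1 / (m : ℝ)) * q) ≤ b ^ (p - 1) * Q := by
      refine le_of_mul_le_mul_left ?_ hp0
      calc p * (((b ^ p) ^ 2)⁻¹ * ((1 / (m : ℝ)) * q))
          = p / (b ^ p) ^ 2 * ((1 / (m : ℝ)) * q) := by ring
        _ ≤ p * (b ^ (p - 1) * Q) := by linarith
    rw [e7, mul_comm (((b ^ p) ^ 2)⁻¹), mul_assoc, inv_mul_le_iff₀ hbq]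
    exact h8
  -- The common vector: `ρᵢ Du(yᵢ) = u(yᵢ) ^ (1 - p) • θ` is the gradient argument of `G F p θ` at
  -- `t = u(yᵢ) ^ p`.
  set θ : Eu n := b ^ (p - 1) • gradient φ x with hθ
  have hgrad : ∀ i : Fin m, rot (ρ i) (gradient u (y i)) = u (y i) ^ (1 - p) • θ := by
    intro i
    refine ext_inner_right ℝ fun ζ => ?_
    have e1 : u (y i) ^ (1 - p) * u (y i) ^ (p - 1) = 1 := by
      rw [← Real.rpow_add (ha i)]; simp
    rw [inner_rot_left, inner_gradient, hθ, inner_smul_left, inner_smul_left, inner_gradient]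
    simp only [RCLike.conj_to_real]
    rw [← first i ζ, ← mul_assoc, e1, one_mul]
  -- At `t = u(yᵢ) ^ p` the factor `t ^ (1/p - 3)` is `u(yᵢ) ^ (1 - 3p)`, which turns `Aᵢ` back into
  -- the rotated Hessian.
  set A : Fin m → Mat n := fun i => u (y i) ^ (3 * p - 1) •
    ((ρ i : Mat n) * hessian u (y i) * (ρ i : Mat n).transpose) with hA
  have hHs : ∀ i, (hessian u (y i)).IsSymm := fun i =>
    hessian_isSymm (hu.contDiffOn.contDiffAt (ho.mem_nhds (hy i)))
  have hAs : ∀ i, (A i).IsSymm := by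
    intro i
    have h1 : ((ρ i : Mat n) * hessian u (y i) * (ρ i : Mat n).transpose).IsSymm := by
      rw [Matrix.IsSymm, Matrix.transpose_mul, Matrix.transpose_mul, Matrix.transpose_transpose,
        (hHs i).eq, Matrix.mul_assoc]
    exact h1.smul _
  have pw : ∀ {a : ℝ} (_ : 0 < a) (k : ℝ), (a ^ p) ^ (1 / p - k) = a ^ (1 - k * p) := by
    intro a ha k
    rw [← Real.rpow_mul ha.le]
    congr 1
    field_simp
  have pw0 : ∀ {a : ℝ} (_ : 0 < a), (a ^ p) ^ (1 / p) = a := by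
    intro a ha
    rw [one_div, Real.rpow_rpow_inv ha.le hp0.ne']
  have hmem : ∀ i : Fin m, (rot (ρ i) (y i), u (y i) ^ p, A i) ∈ superlevelG F p θ := by
    intro i
    refine ⟨Real.rpow_pos_of_pos (ha i) p, hAs i, ?_⟩
    have e1 : u (y i) ^ (1 - 3 * p) • A i =
        (ρ i : Mat n) * hessian u (y i) * (ρ i : Mat n).transpose := by
      rw [hA, smul_smul, ← Real.rpow_add (ha i)]
      simp
    change 0 ≤ F (rot (ρ i) (y i)) ((u (y i) ^ p) ^ (1 / p)) ((u (y i) ^ p) ^ (1 / p - 1) • θ)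
      ((u (y i) ^ p) ^ (1 / p - 3) • A i)
    rw [pw0 (ha i), pw (ha i), pw (ha i), e1, one_mul, ← hgrad i, hFrot _ _ _ _ _ (hHs i)]
    exact (hu.eqn (y i) (hy i)).ge
  -- The mean of the triples stays in the superlevel set; its first two entries are `x` and `b ^ p`.
  have hconv := (hG θ).sum_mem (t := Finset.univ) (w := fun _ : Fin m => 1 / (m : ℝ))
    (fun _ _ => by positivity) (by simp; field_simp) fun i _ => hmem i
  rw [← Finset.smul_sum] at hconv
  obtain ⟨-, hAbs, hge⟩ := hconv
  have c1 : ((1 / (m : ℝ)) • ∑ i : Fin m, (rot (ρ i) (y i), u (y i) ^ p, A i)).1 = x := by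
    rw [Prod.smul_fst, Prod.fst_sum, hxdef, meanMap_apply]
  have c2 : ((1 / (m : ℝ)) • ∑ i : Fin m, (rot (ρ i) (y i), u (y i) ^ p, A i)).2.1 = b ^ p := by
    rw [Prod.smul_snd, Prod.snd_sum, Prod.smul_fst, Prod.fst_sum, hv, avgPow, smul_eq_mul]
  have c3 : ((1 / (m : ℝ)) • ∑ i : Fin m, (rot (ρ i) (y i), u (y i) ^ p, A i)).2.2 =
      (1 / (m : ℝ)) • ∑ i, A i := by
    rw [Prod.smul_snd, Prod.snd_sum, Prod.smul_snd, Prod.snd_sum]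
  rw [c3] at hAbs
  rw [c1, c2, c3, G, pw0 hb0, pw hb0, pw hb0, one_mul, hθ, smul_smul, ← Real.rpow_add hb0,
    show 1 - p + (p - 1) = 0 by ring, Real.rpow_zero, one_smul] at hge
  have hHφ := hessian_isSymm hφ
  -- Ellipticity passes from `b ^ (1 - 3p)` times the mean of the `Aᵢ` to `D²φ(x)`; the matrix
  -- inequality is `second` in quadratic form.
  refine hge.trans (hFell x b _ _ _ (hAbs.smul _) hHφ ?_)
  refine Matrix.PosSemidef.of_dotProduct_mulVec_nonneg ?_ fun w => ?_
  · rw [Matrix.IsHermitian, Matrix.conjTranspose_eq_transpose_of_trivial]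
    exact (hHφ.sub (hAbs.smul _)).eq
  · rw [star_trivial, Matrix.sub_mulVec, dotProduct_sub, sub_nonneg]
    have h1 := second (WithLp.toLp 2 w)
    rw [← dotProduct_hessian_mulVec] at h1
    refine le_trans (le_of_eq ?_) h1
    rw [Matrix.smul_mulVec, Matrix.smul_mulVec, dotProduct_smul, dotProduct_smul,
      Matrix.sum_mulVec, dotProduct_sum, smul_eq_mul, smul_eq_mul]
    congr 2
    refine Finset.sum_congr rfl fun i _ => ?_
    rw [hA, Matrix.smul_mulVec, dotProduct_smul, smul_eq_mul, ← dotProduct_hessian_mulVec,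
      ← dotProduct_conj_mulVec]

end

section

variable {n : ℕ} {Ω : Set (Eu n)} {u : Eu n → ℝ} {p : ℝ} {ρ : ℕ → Rot n} {m : ℕ}

/-! ### Stability -/

/-- The quadratic penalty makes contact strict in the stability argument, and its first and second
derivatives vanish in the limit `x → x₀`, `δ → 0`. -/
lemma hasFDerivAt_mul_norm_sub_sq (δ : ℝ) (x₀ x : Eu n) :
    HasFDerivAt (fun z : Eu n => δ * ‖z - x₀‖ ^ 2) ((2 * δ) • innerSL ℝ (x - x₀)) x := by
  have h1 := (((hasFDerivAt_id x).sub_const x₀).norm_sq).const_mul δ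
  refine h1.congr_fderiv ?_
  ext v
  simp
  ring

lemma fderiv_add_mul_norm_sub_sq {φ : Eu n → ℝ} {x : Eu n} (hφ : DifferentiableAt ℝ φ x) (δ : ℝ)
    (x₀ : Eu n) : fderiv ℝ (fun z => φ z + δ * ‖z - x₀‖ ^ 2) x =
      fderiv ℝ φ x + (2 * δ) • innerSL ℝ (x - x₀) :=
  (hφ.hasFDerivAt.add (hasFDerivAt_mul_norm_sub_sq δ x₀ x)).fderiv

lemma gradient_add_mul_norm_sub_sq {φ : Eu n → ℝ} {x : Eu n} (hφ : DifferentiableAt ℝ φ x) (δ : ℝ)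
    (x₀ : Eu n) : gradient (fun z => φ z + δ * ‖z - x₀‖ ^ 2) x =
      gradient φ x + (2 * δ) • (x - x₀) := by
  refine ext_inner_right ℝ fun v => ?_
  rw [inner_gradient, fderiv_add_mul_norm_sub_sq hφ, inner_add_left, inner_gradient,
    inner_smul_left, RCLike.conj_to_real]
  rfl

lemma hessian_add_mul_norm_sub_sq {φ : Eu n → ℝ} {x : Eu n} (hφ : ContDiffAt ℝ 2 φ x) (δ : ℝ)
    (x₀ : Eu n) : hessian (fun z => φ z + δ * ‖z - x₀‖ ^ 2) x =
      hessian φ x + (2 * δ) • (1 : Mat n) := by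
  have hev : fderiv ℝ (fun z => φ z + δ * ‖z - x₀‖ ^ 2) =ᶠ[𝓝 x]
      fun z => fderiv ℝ φ z + (2 * δ) • innerSL ℝ (z - x₀) := by
    filter_upwards [hφ.eventually (by simp)] with z hz
    exact fderiv_add_mul_norm_sub_sq (hz.differentiableAt (by simp)) δ x₀
  have hd : HasFDerivAt (fderiv ℝ φ) (fderiv ℝ (fderiv ℝ φ) x) x :=
    ((hφ.fderiv_right (m := 1) (by norm_num)).differentiableAt (by simp)).hasFDerivAt
  let J : Eu n →L[ℝ] Eu n →L[ℝ] ℝ := innerSL ℝ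
  have hq : HasFDerivAt (fun z : Eu n => (2 * δ) • J (z - x₀)) ((2 * δ) • J) x :=
    (J.hasFDerivAt.comp x ((hasFDerivAt_id x).sub_const x₀)).const_smul (2 * δ)
  have hsum : fderiv ℝ (fderiv ℝ (fun z => φ z + δ * ‖z - x₀‖ ^ 2)) x =
      fderiv ℝ (fderiv ℝ φ) x + (2 * δ) • J :=
    hev.fderiv_eq.trans (hd.add hq).fderiv
  have hJ : ∀ v w, J v w = inner ℝ v w := fun _ _ => rfl
  refine Matrix.ext fun i j => ?_
  simp only [hessian, hsum]
  by_cases h : i = j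
  · subst h
    simp [hJ]
  · simp [hJ, h, EuclideanSpace.inner_single_left]

lemma continuousAt_gradient {φ : Eu n → ℝ} {x : Eu n} (hφ : ContDiffAt ℝ 2 φ x) :
    ContinuousAt (gradient φ) x :=
  (InnerProductSpace.toDual ℝ (Eu n)).symm.continuous.continuousAt.comp
    (hφ.fderiv_right (m := 1) (by norm_num)).continuousAt

lemma continuousAt_hessian {φ : Eu n → ℝ} {x : Eu n} (hφ : ContDiffAt ℝ 2 φ x) :
    ContinuousAt (hessian φ) x := by
  have h : ContinuousAt (fderiv ℝ (fderiv ℝ φ)) x :=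
    ((hφ.fderiv_right (m := 1) (by norm_num)).fderiv_right (m := 0) (by norm_num)).continuousAt
  refine continuousAt_pi.2 fun i => continuousAt_pi.2 fun j => ?_
  exact (h.clm_apply continuousAt_const).clm_apply continuousAt_const

lemma continuous_rotationMeanFun (hp : 0 < p) (ho : IsOpen Ω)
    (hb : Bornology.IsBounded Ω) (hc : Convex ℝ Ω) (hne : Ω.Nonempty)
    (hcu : ContinuousOn u (closure Ω)) (hu0 : ∀ x ∈ closure Ω, 0 ≤ u x)
    (hbd : ∀ x ∈ frontier Ω, u x = 0) : Continuous (rotationMeanFun p Ω u ρ m) :=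
  Metric.continuous_iff.2 fun x ε hε => by
    obtain ⟨δ, hδ, h⟩ :=
      (rotationMeanFun_equicontinuous (p := p) hp ho hb hc hne hcu hu0 hbd).2 ε hε
    exact ⟨δ, hδ, fun a ha => h ρ m a x ha⟩

lemma IsRearrangement.continuousOn (hp : 0 < p) (ho : IsOpen Ω)
    (hb : Bornology.IsBounded Ω) (hc : Convex ℝ Ω) (hne : Ω.Nonempty)
    (hcu : ContinuousOn u (closure Ω)) (hu0 : ∀ x ∈ closure Ω, 0 ≤ u x)
    (hbd : ∀ x ∈ frontier Ω, u x = 0) {c : Eu n} {U : Eu n → ℝ}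
    (hU : IsRearrangement p Ω u ρ c U) : ContinuousOn U (closure (sharpBall Ω c)) := by
  obtain ⟨ψ, -, hconv⟩ := hU
  exact hconv.continuousOn (Frequently.of_forall fun k =>
    (continuous_rotationMeanFun hp ho hb hc hne hcu hu0 hbd).continuousOn)

/-- Points of the sphere lie outside the open ball, where the means are eventually at most any `ε >
0`. -/
lemma IsRearrangement.nonpos_of_mem_frontier (hp : 0 < p) (ho : IsOpen Ω)
    (hb : Bornology.IsBounded Ω) (hc : Convex ℝ Ω) (hne : Ω.Nonempty)
    (hcu : ContinuousOn u (closure Ω)) (hu0 : ∀ x ∈ closure Ω, 0 ≤ u x)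
    (hbd : ∀ x ∈ frontier Ω, u x = 0) (hw : 0 < meanWidth Ω) {c : Eu n}
    (hsym : IsSymmetrizing Ω ρ c) {U : Eu n → ℝ} (hU : IsRearrangement p Ω u ρ c U) {x : Eu n}
    (hx : x ∈ frontier (sharpBall Ω c)) : U x ≤ 0 := by
  obtain ⟨ψ, hψ, hconv⟩ := hU
  refine le_of_forall_pos_le_add fun ε hε => ?_
  rw [zero_add]
  have hlim := hconv.tendsto_at (frontier_subset_closure hx)
  have hxn : x ∉ sharpBall Ω c := by
    have hopen : IsOpen (sharpBall Ω c) := isOpen_ball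
    have := hx.2
    rwa [hopen.interior_eq] at this
  refine le_of_tendsto hlim ?_
  filter_upwards [hψ.tendsto_atTop.eventually
    (eventually_rotationMeanFun_le_of_notMem hp ho hb hc hne hcu hu0 hbd hsym hw hε)] with k hk
  exact hk x hxn

/-- Mean width rearrangements of a solution are viscosity subsolutions. -/
theorem IsRearrangement.isViscositySubsolution {F : Operator n} (hFcont : IsContinuous F)
    (hFell : IsDegenerateElliptic F)
    (hFrot : IsRotationInvariant F) (hp0 : 0 < p) (hp1 : p < 1)
    (hG : ∀ θ : Eu n, Convex ℝ (superlevelG F p θ)) (ho : IsOpen Ω)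
    (hb : Bornology.IsBounded Ω) (hc : Convex ℝ Ω) (hne : Ω.Nonempty)
    (hu : IsClassicalSolution F Ω u) (hu0 : ∀ x ∈ closure Ω, 0 ≤ u x)
    (hslope : HasPositiveInwardSlope Ω u) {c : Eu n} (hsym : IsSymmetrizing Ω ρ c)
    {U : Eu n → ℝ} (hU : IsRearrangement p Ω u ρ c U) :
    IsViscositySubsolution F (sharpBall Ω c) U := by
  have hopen : IsOpen (sharpBall Ω c) := isOpen_ball
  have hUc := hU.continuousOn hp0 ho hb hc hne hu.continuousOn hu0 hu.boundary
  refine ⟨(hUc.mono subset_closure).upperSemicontinuousOn, ?_⟩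
  intro x₀ hx₀ φ hφ htouch
  obtain ⟨heq, hle⟩ := htouch
  obtain ⟨ψ, hψ, hconv⟩ := hU
  obtain ⟨r₁, hr₁, hev₁⟩ := eventually_closedBall_subset_rotationMean ho hb hc hne hsym hx₀
  obtain ⟨r₂, hr₂, hball₂⟩ := Metric.isOpen_iff.1 hopen x₀ hx₀
  obtain ⟨r₃, hr₃, hball₃⟩ := Metric.eventually_nhds_iff_ball.1 hle
  have hφat : ∀ x ∈ sharpBall Ω c, ContDiffAt ℝ 2 φ x := fun x hx =>
    hφ.contDiffAt (hopen.mem_nhds hx)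
  set R := min r₁ (min r₂ r₃) with hR
  have hR0 : 0 < R := lt_min hr₁ (lt_min hr₂ hr₃)
  -- A mean function close to `U` is touched from above, up to a constant, near `x₀` by `φ` plus the
  -- penalty `δ ‖z - x₀‖ ^ 2`; its subsolution inequality holds at the contact point.
  have claim : ∀ δ : ℝ, 0 < δ → δ < R → ∃ (x : Eu n) (s : ℝ), dist x x₀ < δ ∧ |s - U x| < δ ∧
      x ∈ sharpBall Ω c ∧
      0 ≤ F x s (gradient φ x + (2 * δ) • (x - x₀)) (hessian φ x + (2 * δ) • (1 : Mat n)) := by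
    intro δ hδ hδR
    have hδ₁ : δ ≤ r₁ := hδR.le.trans (min_le_left _ _)
    have hδ₂ : δ < r₂ := hδR.trans_le ((min_le_right _ _).trans (min_le_left _ _))
    have hδ₃ : δ < r₃ := hδR.trans_le ((min_le_right _ _).trans (min_le_right _ _))
    have hsub : closedBall x₀ δ ⊆ sharpBall Ω c := (closedBall_subset_ball hδ₂).trans hball₂
    -- On the sphere of radius `δ` the penalty is `δ ^ 3 ≥ 2ε`, more than the approximation errors
    -- at `x` and `x₀` together, so the maximum is interior. The bound `ε ≤ δ` controls the value at
    -- the contact point.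
    set ε := min δ (δ * δ ^ 2 / 2) with hε
    have hε0 : 0 < ε := lt_min hδ (by positivity)
    obtain ⟨k, hk1, hk2, hk3⟩ := ((Metric.tendstoUniformlyOn_iff.1 hconv ε hε0).and
      ((hψ.tendsto_atTop.eventually hev₁).and
        (hψ.tendsto_atTop.eventually (eventually_gt_atTop 0)))).exists
    set f := rotationMeanFun p Ω u ρ (ψ k) with hf
    have hfc : Continuous f :=
      continuous_rotationMeanFun hp0 ho hb hc hne hu.continuousOn hu0 hu.boundary
    have hclose : ∀ x ∈ closedBall x₀ δ, |U x - f x| < ε := fun x hx =>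
      hk1 x (subset_closure (hsub hx))
    have hφc : ContinuousOn φ (closedBall x₀ δ) := hφ.continuousOn.mono hsub
    obtain ⟨x, hx, hmax⟩ := (isCompact_closedBall x₀ δ).exists_isMaxOn
      ⟨x₀, mem_closedBall_self hδ.le⟩
      (f := fun z => f z - (φ z + δ * ‖z - x₀‖ ^ 2))
      (hfc.continuousOn.sub (hφc.add (by fun_prop)))
    have hlt : dist x x₀ < δ := by
      refine lt_of_le_of_ne (mem_closedBall.1 hx) fun hxδ => ?_
      have h1 := hmax (mem_closedBall_self hδ.le)
      simp only [mem_ofPred_eq, sub_self, norm_zero] at h1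
      have h2 := (abs_lt.1 (hclose x hx)).1
      have h3 := (abs_lt.1 (hclose x₀ (mem_closedBall_self hδ.le))).2
      have h4 : U x ≤ φ x := hball₃ x (mem_ball.2 (by rw [hxδ]; exact hδ₃))
      rw [← dist_eq_norm, hxδ] at h1
      have h5 : ε ≤ δ * δ ^ 2 / 2 := min_le_right _ _
      linarith
    have hloc : IsLocalMax (fun z => f z - (φ z + δ * ‖z - x₀‖ ^ 2)) x :=
      hmax.isLocalMax (closedBall_mem_nhds_of_mem hlt)
    have hxs := hsub hx
    have hvis := rotationMeanFun_subsolution hFell hFrot hp0 hp1 hG ho hb hc hu hu0 hslope hk3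
      (hk2 (closedBall_subset_closedBall hδ₁ hx)) (φ := fun z => φ z + δ * ‖z - x₀‖ ^ 2)
      ((hφat x hxs).add (contDiffAt_const.mul
        ((contDiffAt_id.sub contDiffAt_const).norm_sq ℝ))) hloc
    rw [gradient_add_mul_norm_sub_sq ((hφat x hxs).differentiableAt (by simp)),
      hessian_add_mul_norm_sub_sq (hφat x hxs)] at hvis
    refine ⟨x, f x, hlt, ?_, hxs, hvis⟩
    rw [abs_sub_comm]
    exact (hclose x hx).trans_le (min_le_left _ _)
  -- The shift by `2` gives `δ k < R` already for `k = 0`.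
  set δ : ℕ → ℝ := fun k => R / ((k : ℝ) + 2) with hδ
  have hδ0 : ∀ k, 0 < δ k := fun k => by positivity
  have hδR : ∀ k, δ k < R := fun k => by
    rw [hδ, div_lt_iff₀ (by positivity)]
    nlinarith [(Nat.cast_nonneg k : (0 : ℝ) ≤ k)]
  have hδlim : Tendsto δ atTop (𝓝 0) :=
    tendsto_const_nhds.div_atTop (tendsto_natCast_atTop_atTop.atTop_add tendsto_const_nhds)
  choose x s hxd hsd hxin hF using fun k => claim (δ k) (hδ0 k) (hδR k)
  have hxlim : Tendsto x atTop (𝓝 x₀) :=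
    tendsto_iff_dist_tendsto_zero.2 (squeeze_zero (fun _ => dist_nonneg) (fun k => (hxd k).le) hδlim)
  have hslim : Tendsto s atTop (𝓝 (U x₀)) := by
    have h1 : Tendsto (fun k => U (x k)) atTop (𝓝 (U x₀)) :=
      ((hUc.mono subset_closure).continuousAt (hopen.mem_nhds hx₀)).tendsto.comp hxlim
    have h2 : Tendsto (fun k => s k - U (x k)) atTop (𝓝 0) :=
      squeeze_zero_norm (fun k => (hsd k).le) hδlim
    simpa using h2.add h1
  have hglim : Tendsto (fun k => gradient φ (x k) + (2 * δ k) • (x k - x₀)) atTop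
      (𝓝 (gradient φ x₀)) := by
    have h1 := (continuousAt_gradient (hφat x₀ hx₀)).tendsto.comp hxlim
    have h2 := (hδlim.const_mul 2).smul (hxlim.sub_const x₀)
    simpa using h1.add h2
  have hhlim : Tendsto (fun k => hessian φ (x k) + (2 * δ k) • (1 : Mat n)) atTop
      (𝓝 (hessian φ x₀)) := by
    have h1 := (continuousAt_hessian (hφat x₀ hx₀)).tendsto.comp hxlim
    have h2 := (hδlim.const_mul 2).smul_const (1 : Mat n)
    simpa using h1.add h2
  have hsymm₀ : (x₀, U x₀, gradient φ x₀, hessian φ x₀) ∈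
      {z : Eu n × ℝ × Eu n × Mat n | z.2.2.2.IsSymm} := hessian_isSymm (hφat x₀ hx₀)
  -- `F` is continuous only along symmetric matrices, so the convergence is taken within that set.
  have hlim := (hFcont _ hsymm₀).tendsto.comp (tendsto_nhdsWithin_iff.2
    ⟨hxlim.prodMk_nhds (hslim.prodMk_nhds (hglim.prodMk_nhds hhlim)),
      Eventually.of_forall fun k =>
        (hessian_isSymm (hφat _ (hxin k))).add (Matrix.isSymm_one.smul _)⟩)
  exact ge_of_tendsto' hlim hF

/-! ### Comparison of distribution functions -/

lemma eLpNorm_eq_lintegral_distribution {α : Type*} [MeasurableSpace α] {μ : Measure α}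
    {f : α → ℝ} (hf : AEMeasurable f μ) (hf0 : 0 ≤ᵐ[μ] f) {q : ℝ≥0∞} (hq : 0 < q) (hqt : q ≠ ⊤) :
    eLpNorm f q μ = (ENNReal.ofReal q.toReal *
      ∫⁻ t in Ioi 0, μ {a | t < f a} * ENNReal.ofReal (t ^ (q.toReal - 1))) ^ (1 / q.toReal) := by
  have hqr : 0 < q.toReal := ENNReal.toReal_pos hq.ne' hqt
  rw [eLpNorm_eq_lintegral_rpow_enorm_toReal hq.ne' hqt,
    ← lintegral_rpow_eq_lintegral_meas_lt_mul μ hf0 hf hqr]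
  congr 1
  refine lintegral_congr_ae ?_
  filter_upwards [hf0] with x hx
  rw [Real.enorm_of_nonneg hx, ENNReal.ofReal_rpow_of_nonneg hx hqr.le]

/-- For finite `q` this is the layer cake formula; for `q = ∞` the distribution function of `f`
vanishes at the essential supremum of `g`. -/
lemma eLpNorm_le_of_distribution_le {α β : Type*} [MeasurableSpace α] [MeasurableSpace β]
    {μ : Measure α} {ν : Measure β} {f : α → ℝ} {g : β → ℝ} (hf : AEMeasurable f μ)
    (hg : AEMeasurable g ν) (hf0 : 0 ≤ᵐ[μ] f) (hg0 : 0 ≤ᵐ[ν] g)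
    (h : ∀ t : ℝ, 0 ≤ t → μ {x | t < f x} ≤ ν {x | t < g x}) {q : ℝ≥0∞} (hq : 0 < q) :
    eLpNorm f q μ ≤ eLpNorm g q ν := by
  rcases eq_or_ne q ⊤ with rfl | hqt
  · rw [eLpNorm_exponent_top, eLpNorm_exponent_top]
    rcases eq_or_ne (eLpNormEssSup g ν) ⊤ with htop | htop
    · rw [htop]; exact le_top
    set C := (eLpNormEssSup g ν).toReal with hC
    have hgC : ν {x | C < g x} = 0 := by
      have h1 := enorm_ae_le_eLpNormEssSup g ν
      rw [ae_iff] at h1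
      refine measure_mono_null (fun x hx => ?_) h1
      have hx' : C < g x := hx
      rw [mem_ofPred_eq, not_le, ← ENNReal.ofReal_toReal htop, ← hC, Real.enorm_eq_ofReal_abs]
      exact (ENNReal.ofReal_lt_ofReal_iff_of_nonneg ENNReal.toReal_nonneg).2
        (hx'.trans_le (le_abs_self _))
    have hfC : ∀ᵐ x ∂μ, f x ≤ C := by
      rw [ae_iff]
      simp only [not_le]
      exact le_antisymm ((h C ENNReal.toReal_nonneg).trans hgC.le) (zero_le)
    refine eLpNormEssSup_le_of_ae_enorm_bound ?_
    filter_upwards [hfC, hf0] with x hx hx0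
    rw [Real.enorm_of_nonneg hx0, ← ENNReal.ofReal_toReal htop]
    exact ENNReal.ofReal_le_ofReal hx
  · rw [eLpNorm_eq_lintegral_distribution hf hf0 hq hqt,
      eLpNorm_eq_lintegral_distribution hg hg0 hq hqt]
    gcongr ((_ * ?_) ^ _)
    refine setLIntegral_mono' measurableSet_Ioi fun t ht => ?_
    gcongr
    exact h t (le_of_lt ht)

/-- The level sets of `u` are no larger than those of any majorant of a rearrangement. -/
lemma volume_superlevel_le (hp : 0 < p) (ho : IsOpen Ω)
    (hb : Bornology.IsBounded Ω) (hc : Convex ℝ Ω) (hne : Ω.Nonempty)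
    (hcu : ContinuousOn u (closure Ω)) (hu0 : ∀ x ∈ closure Ω, 0 ≤ u x)
    (hbd : ∀ x ∈ frontier Ω, u x = 0) (hw : 0 < meanWidth Ω) {c : Eu n}
    (hsym : IsSymmetrizing Ω ρ c) {U v : Eu n → ℝ} (hU : IsRearrangement p Ω u ρ c U)
    (hUv : ∀ x ∈ sharpBall Ω c, U x ≤ v x) {t : ℝ} (ht : 0 ≤ t) :
    volume ({x | t < u x} ∩ Ω) ≤ volume ({x | t < v x} ∩ sharpBall Ω c) := by
  obtain ⟨ψ, hψ, hconv⟩ := hU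
  have hKcomp : ∀ s : ℝ, IsCompact (closure Ω ∩ u ⁻¹' Ici s) := fun s =>
    (isCompact_closure_of_isBounded hb).of_isClosed_subset
      (hcu.preimage_isClosed_of_isClosed isClosed_closure isClosed_Ici) inter_subset_left
  have hstep : ∀ s : ℝ, t < s →
      volume (closure Ω ∩ u ⁻¹' Ici s) ≤ volume ({x | t < v x} ∩ sharpBall Ω c) := by
    intro s hts
    have hs0 : 0 < s := ht.trans_lt hts
    -- The index makes the uniform error smaller than `s - t` and the mean function at most `s / 2`
    -- off the ball; so wherever it is at least `s`, the point is in the ball and `v > t` there.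
    obtain ⟨k, hk1, hk2, hk3⟩ := ((Metric.tendstoUniformlyOn_iff.1 hconv (s - t)
      (by linarith)).and ((hψ.tendsto_atTop.eventually
        (eventually_rotationMeanFun_le_of_notMem hp ho hb hc hne hcu hu0 hbd hsym hw
          (half_pos hs0))).and (hψ.tendsto_atTop.eventually (eventually_gt_atTop 0)))).exists
    obtain ⟨l, hl⟩ := Nat.exists_eq_succ_of_ne_zero hk3.ne'
    refine (volume_le_volume_image_meanMap (hKcomp s) ρ l).trans (measure_mono ?_)
    rw [← Nat.succ_eq_add_one, ← hl]
    rintro _ ⟨y, hy, rfl⟩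
    have hyc : ∀ i, y i ∈ closure Ω := fun i => (hy i (mem_univ i)).1
    have hys : ∀ i, s ≤ u (y i) := fun i => (hy i (mem_univ i)).2
    set z := meanMap ρ (ψ k) y
    have hm' : (0 : ℝ) < ψ k := by exact_mod_cast hk3
    -- A `p`-mean of values at least `s` is at least `s`, so the rotation mean of `{u ≥ s}` lies in
    -- the corresponding superlevel set.
    have hge : s ≤ rotationMeanFun p Ω u ρ (ψ k) z := by
      have h1 : s ^ p ≤ avgPow p u y := by
        have h2 : ∑ _i : Fin (ψ k), s ^ p ≤ ∑ i, u (y i) ^ p :=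
          Finset.sum_le_sum fun i _ => Real.rpow_le_rpow hs0.le (hys i) hp.le
        rw [Finset.sum_const, Finset.card_univ, Fintype.card_fin, nsmul_eq_mul] at h2
        rw [avgPow, one_div, ← div_eq_inv_mul, le_div_iff₀ hm']
        linarith
      exact (Real.rpow_le_rpow_iff hs0.le (rotationMeanFun_nonneg hu0 _) hp).1
        (h1.trans (avgPow_le_rotationMeanFun hp hb hcu hu0 hyc))
    have hzin : z ∈ sharpBall Ω c := by
      by_contra hzn
      have := hk2 z hzn
      linarith
    refine ⟨?_, hzin⟩
    have h3 := hk1 z (subset_closure hzin)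
    rw [Real.dist_eq] at h3
    have h4 := (abs_lt.1 h3).1
    have h5 := hUv z hzin
    rw [mem_ofPred_eq]
    linarith
  -- The strict superlevel set is exhausted by the increasing compact sets `{u ≥ t + 1 / (j + 1)}`.
  have hunion : {x | t < u x} ∩ Ω ⊆ ⋃ j : ℕ, closure Ω ∩ u ⁻¹' Ici (t + 1 / ((j : ℝ) + 1)) := by
    rintro x ⟨hx, hxΩ⟩
    have hx' : 0 < u x - t := sub_pos.2 hx
    obtain ⟨j, hj⟩ := exists_nat_one_div_lt hx'
    refine mem_iUnion.2 ⟨j, subset_closure hxΩ, ?_⟩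
    rw [mem_preimage, mem_Ici]
    linarith
  refine (measure_mono hunion).trans ?_
  have hmono : Monotone fun j : ℕ => closure Ω ∩ u ⁻¹' Ici (t + 1 / ((j : ℝ) + 1)) := by
    intro i j hij x hx
    refine ⟨hx.1, ?_⟩
    have h1 : (1 : ℝ) / ((j : ℝ) + 1) ≤ 1 / ((i : ℝ) + 1) := by gcongr
    have h2 : t + 1 / ((i : ℝ) + 1) ≤ u x := hx.2
    rw [mem_preimage, mem_Ici]
    linarith
  rw [hmono.measure_iUnion]
  exact iSup_le fun j => hstep _ (lt_add_of_pos_right t (by positivity))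

end

end MeanWidth

/-! ### ### The comparison theorem -/

theorem theorem6p5 (n : ℕ) (hn : 2 ≤ n)
    (F : MeanWidth.Operator n) (hFcont : MeanWidth.IsContinuous F)
    (hFproper : MeanWidth.IsProper F) (hFell : MeanWidth.IsDegenerateElliptic F)
    (hFrot : MeanWidth.IsRotationInvariant F)
    (Ω : Set (MeanWidth.Eu n)) (hΩopen : IsOpen Ω) (hΩbdd : Bornology.IsBounded Ω)
    (hΩconv : Convex ℝ Ω) (hΩne : Ω.Nonempty)
    (u : MeanWidth.Eu n → ℝ) (hu : MeanWidth.IsClassicalSolution F Ω u)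
    (hslope : MeanWidth.HasPositiveInwardSlope Ω u)
    (p : ℝ) (hp0 : 0 < p) (hp1 : p < 1)
    (hG : ∀ θ : MeanWidth.Eu n, Convex ℝ (MeanWidth.superlevelG F p θ)) :
    (∃ ρ : ℕ → MeanWidth.Rot n, MeanWidth.IsSymmetrizing Ω ρ 0) ∧
    ∀ (ρ : ℕ → MeanWidth.Rot n) (c : MeanWidth.Eu n), MeanWidth.IsSymmetrizing Ω ρ c →
      (∃ U : MeanWidth.Eu n → ℝ, MeanWidth.IsRearrangement p Ω u ρ c U) ∧
      (MeanWidth.ComparisonPrinciple F (MeanWidth.sharpBall Ω c) →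
        ∀ v : MeanWidth.Eu n → ℝ,
          MeanWidth.IsClassicalSolution F (MeanWidth.sharpBall Ω c) v →
          (∀ U : MeanWidth.Eu n → ℝ, MeanWidth.IsRearrangement p Ω u ρ c U →
            ∀ x ∈ MeanWidth.sharpBall Ω c, U x ≤ v x) ∧
          ∀ q : ENNReal, 0 < q →
            MeasureTheory.eLpNorm u q (MeasureTheory.volume.restrict Ω) ≤
              MeasureTheory.eLpNorm v q
                (MeasureTheory.volume.restrict (MeanWidth.sharpBall Ω c))) := by
  have hu0 : ∀ x ∈ closure Ω, 0 ≤ u x := by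
    intro x hx
    by_cases hxΩ : x ∈ Ω
    · exact (hu.pos x hxΩ).le
    · exact (hu.boundary x ⟨hx, by rwa [hΩopen.interior_eq]⟩).ge
  have hw := MeanWidth.meanWidth_pos hn hΩopen hΩbdd hΩne
  refine ⟨MeanWidth.exists_isSymmetrizing hn hΩopen hΩbdd hΩconv hΩne, fun ρ c hsym => ?_⟩
  have hex := MeanWidth.exists_isRearrangement hp0 hΩopen hΩbdd hΩconv hΩne hu.continuousOn hu0
    hu.boundary ρ c
  refine ⟨hex, fun hcomp v hv => ?_⟩
  have hle : ∀ U : MeanWidth.Eu n → ℝ, MeanWidth.IsRearrangement p Ω u ρ c U →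
      ∀ x ∈ MeanWidth.sharpBall Ω c, U x ≤ v x := by
    intro U hU
    refine hcomp v U ⟨hv.contDiffOn, hv.continuousOn, fun x hx => (hv.eqn x hx).le⟩
      (hU.continuousOn hp0 hΩopen hΩbdd hΩconv hΩne hu.continuousOn hu0 hu.boundary)
      (hU.isViscositySubsolution hFcont hFell hFrot hp0 hp1 hG hΩopen hΩbdd hΩconv hΩne hu hu0
        hslope hsym) fun x hx => ?_
    rw [hv.boundary x hx]
    exact hU.nonpos_of_mem_frontier hp0 hΩopen hΩbdd hΩconv hΩne hu.continuousOn hu0 hu.boundary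
      hw hsym hx
  refine ⟨hle, fun q hq => ?_⟩
  -- The norm inequality does not mention the rearrangement, so any one of them serves as
  -- intermediary.
  obtain ⟨U, hU⟩ := hex
  have hball : IsOpen (MeanWidth.sharpBall Ω c) := isOpen_ball
  refine MeanWidth.eLpNorm_le_of_distribution_le
    ((hu.contDiffOn.continuousOn).aemeasurable hΩopen.measurableSet)
    ((hv.contDiffOn.continuousOn).aemeasurable hball.measurableSet)
    ((ae_restrict_mem hΩopen.measurableSet).mono fun x hx => (hu.pos x hx).le)
    ((ae_restrict_mem hball.measurableSet).mono fun x hx => (hv.pos x hx).le)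
    (fun t ht => ?_) hq
  rw [Measure.restrict_apply' hΩopen.measurableSet, Measure.restrict_apply' hball.measurableSet]
  exact MeanWidth.volume_superlevel_le hp0 hΩopen hΩbdd hΩconv hΩne hu.continuousOn hu0 hu.boundary
    hw hsym hU (hle U hU) ht
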